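/- Let $B_n$ be the Artin braid group with generators $\sigma_1,\dots,\sigma_{n-1}$ and relations $\sigma_i\sigma_{i+1}\sigma_i=\sigma_{i+1}\sigma_i\sigma_{i+1}$ for $1\le i\le n-2$ and $\sigma_i\sigma_j=\sigma_j\sigma_i$ for $|i-j|\ge 2$. Let $\Sigma_n$ be the symmetric group, let $P_n=\ker(B_n\to\Sigma_n)$, where $\sigma_i\mapsto(i\ \,i+1)$, be the pure braid group, and for $1\le i<j\le n$ let $$A_{i,j}=\sigma_{j-1}\cdots\sigma_{i+1}\,\sigma_i^{2}\,\sigma_{i+1}^{-1}\cdots\sigma_{j-1}^{-1}\in P_n .$$ Write $[u,v]=uvu^{-1}v^{-1}$. A group $G$ is residually free if for every $g\ne 1$ in $G$ there is a homomorphism $f$ from $G$ to a free group with $f(g)\neq 1$. Let $F_2=\langle x,y\rangle$ be the free group on two generators. For $I=\{i<j<k\}\subset\{1,\dots,n\}$ let $f_I\colon P_n\to F_2$ be the homomorphism with $$f_I(A_{i,j})=x,\quad f_I(A_{i,k})=y,\quad f_I(A_{j,k})=y^{-1}x^{-1},$$ and $f_I(A_{r,s})=1$ for all other $r<s$. For $I=\{i<j<k<l\}\subset\{1,\dots,n\}$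 let $f_I\colon P_n\to F_2$ be the homomorphism with $$f_I(A_{i,j})=f_I(A_{k,l})=x,\quad f_I(A_{i,k})=y,\quad f_I(A_{j,l})=xyx^{-1},\quad f_I(A_{j,k})=f_I(A_{i,l})=y^{-1}x^{-1},$$ and $f_I(A_{r,s})=1$ for all other $r<s$. **Theorem.** Let $n\ge 4$. The pure braid group $P_n$ is not residually free. More precisely, let $$w=[[A_{1,2},A_{2,3}],[A_{2,3},A_{3,4}]]\in P_n .$$ Then: 1. $w\neq 1$, and $w$ lies in the commutator subgroup $[P_n,P_n]$. For $n=4$ the braid $w$ is Brunnian: the deletion of any one of its four strands gives the trivial braid on three strands. 2. For every $I\subset\{1,\dots,n\}$ with $|I|\in\{3,4\}$ there is exactly one homomorphism $f_I$ with the values above; it is surjective, and $f_I(w)=1$. 3. $f(w)=1$ for every homomorphism $f$ from $P_n$ to a free group. -/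

import Mathlib

open scoped commutatorElement

/-- The defining relations of the Artin braid group on `n` strands. The generator `σ_{i+1}` of the
literature, which crosses the strands in the positions `i` and `i + 1` (counted from `0`), has the
index `i : Fin (n - 1)`. -/
def braidRelations (n : ℕ) : Set (FreeGroup (Fin (n - 1))) :=
  {w | ∃ i j : Fin (n - 1), (i : ℕ) + 1 = j ∧
      w = (FreeGroup.of i * FreeGroup.of j * FreeGroup.of i) *
        (FreeGroup.of j * FreeGroup.of i * FreeGroup.of j)⁻¹} ∪
  {w | ∃ i j : Fin (n - 1), (i : ℕ) + 2 ≤ j ∧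
      w = (FreeGroup.of i * FreeGroup.of j) * (FreeGroup.of j * FreeGroup.of i)⁻¹}

/-- The Artin braid group `B_n`. -/
abbrev BraidGroup (n : ℕ) : Type := PresentedGroup (braidRelations n)

/-- The Artin generators of `B_n`, with indices `0, …, n - 2`; the value outside this range is a
convention that is never used. -/
def braidSigma (n i : ℕ) : BraidGroup n :=
  if h : i < n - 1 then PresentedGroup.of ⟨i, h⟩ else 1

theorem braidSigma_braid (n i : ℕ) (h : i + 1 < n - 1) :
    braidSigma n i * braidSigma n (i + 1) * braidSigma n i =
      braidSigma n (i + 1) * braidSigma n i * braidSigma n (i + 1) := by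
  rw [braidSigma, braidSigma, dif_pos (by omega), dif_pos h]
  refine PresentedGroup.mk_eq_mk_of_mul_inv_mem (rels := braidRelations n)
    (x := FreeGroup.of ⟨i, by omega⟩ * FreeGroup.of ⟨i + 1, h⟩ * FreeGroup.of ⟨i, by omega⟩)
    (y := FreeGroup.of ⟨i + 1, h⟩ * FreeGroup.of ⟨i, by omega⟩ * FreeGroup.of ⟨i + 1, h⟩) ?_
  exact Or.inl ⟨_, _, rfl, rfl⟩

theorem braidSigma_comm (n i j : ℕ) (h : i + 2 ≤ j) :
    braidSigma n i * braidSigma n j = braidSigma n j * braidSigma n i := by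
  by_cases hj : j < n - 1
  · rw [braidSigma, braidSigma, dif_pos (by omega), dif_pos hj]
    refine PresentedGroup.mk_eq_mk_of_mul_inv_mem (rels := braidRelations n)
      (x := FreeGroup.of ⟨i, by omega⟩ * FreeGroup.of ⟨j, hj⟩)
      (y := FreeGroup.of ⟨j, hj⟩ * FreeGroup.of ⟨i, by omega⟩) ?_
    exact Or.inr ⟨_, _, h, rfl⟩
  · have : braidSigma n j = 1 := dif_neg hj
    simp [this]

/-- A map on the Artin generators that respects the braid relations extends to `B_n`. -/
def braidLift {n : ℕ} {G : Type*} [Group G] (f : Fin (n - 1) → G)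
    (h1 : ∀ i j : Fin (n - 1), (i : ℕ) + 1 = j → f i * f j * f i = f j * f i * f j)
    (h2 : ∀ i j : Fin (n - 1), (i : ℕ) + 2 ≤ j → f i * f j = f j * f i) : BraidGroup n →* G :=
  PresentedGroup.toGroup (rels := braidRelations n) (f := f) (by
    rintro w (⟨i, j, hij, rfl⟩ | ⟨i, j, hij, rfl⟩)
    · simp only [map_mul, map_inv, FreeGroup.lift_apply_of]
      rw [h1 i j hij, mul_inv_cancel]
    · simp only [map_mul, map_inv, FreeGroup.lift_apply_of]
      rw [h2 i j hij, mul_inv_cancel])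

theorem braidLift_of {n : ℕ} {G : Type*} [Group G] (f : Fin (n - 1) → G)
    (h1 : ∀ i j : Fin (n - 1), (i : ℕ) + 1 = j → f i * f j * f i = f j * f i * f j)
    (h2 : ∀ i j : Fin (n - 1), (i : ℕ) + 2 ≤ j → f i * f j = f j * f i) (i : Fin (n - 1)) :
    braidLift f h1 h2 (PresentedGroup.of i) = f i := by
  unfold braidLift
  exact PresentedGroup.toGroup.of _

/-- The transposition of the positions `i` and `i + 1`. -/
def adjSwap {n : ℕ} (i : Fin (n - 1)) : Equiv.Perm (Fin n) :=
  Equiv.swap ⟨i, by omega⟩ ⟨i + 1, by omega⟩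

theorem adjSwap_val {n : ℕ} (i : Fin (n - 1)) (k : Fin n) :
    (adjSwap i k : ℕ) =
      if (k : ℕ) = i then (i : ℕ) + 1 else if (k : ℕ) = i + 1 then (i : ℕ) else k := by
  unfold adjSwap
  rw [Equiv.swap_apply_def]
  simp only [Fin.ext_iff]
  split_ifs <;> simp

theorem adjSwap_braid {n : ℕ} (i j : Fin (n - 1)) (h : (i : ℕ) + 1 = j) :
    adjSwap i * adjSwap j * adjSwap i = adjSwap j * adjSwap i * (adjSwap j : Equiv.Perm (Fin n)) := by
  obtain ⟨i, hi⟩ := i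
  obtain ⟨j, hj⟩ := j
  simp only at h
  subst h
  ext ⟨k, hk⟩
  simp only [Equiv.Perm.mul_apply, adjSwap_val]
  have a2 : i ≠ i + 1 + 1 := by omega
  rcases eq_or_ne k i with rfl | h1
  · simp [a2, a2.symm]
  rcases eq_or_ne k (i + 1) with rfl | h2
  · simp [a2, a2.symm]
  rcases eq_or_ne k (i + 1 + 1) with rfl | h3
  · simp [a2, a2.symm]
  · simp [h1, h2, h3]

theorem adjSwap_comm {n : ℕ} (i j : Fin (n - 1)) (h : (i : ℕ) + 2 ≤ j) :
    adjSwap i * adjSwap j = adjSwap j * (adjSwap i : Equiv.Perm (Fin n)) := by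
  ext k
  simp only [Equiv.Perm.mul_apply, adjSwap_val]
  split_ifs <;> omega

/-- The natural map `B_n → Σ_n`. -/
def braidPerm (n : ℕ) : BraidGroup n →* Equiv.Perm (Fin n) :=
  braidLift adjSwap adjSwap_braid adjSwap_comm

/-- The pure braid group `P_n = ker (B_n → Σ_n)`. -/
abbrev PureBraidGroup (n : ℕ) : Type := (braidPerm n).ker

theorem braidPerm_sigma_sq (n i : ℕ) : braidPerm n (braidSigma n i) ^ 2 = 1 := by
  unfold braidSigma
  split_ifs with h
  · have : braidPerm n (PresentedGroup.of ⟨i, h⟩) = adjSwap ⟨i, h⟩ := braidLift_of ..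
    rw [this, pow_two, adjSwap, Equiv.swap_mul_self]
  · simp

/-- The product `σ_{j-1} ⋯ σ_{i+1}` (empty if `j ≤ i + 1`). -/
def braidDescending (n i j : ℕ) : BraidGroup n :=
  ((List.range' (i + 1) (j - 1 - i)).reverse.map (braidSigma n)).prod

/-- The standard generators of `P_n`, for `i < j`:
`A_{i,j} = (σ_{j-1} ⋯ σ_{i+1}) σ_i² (σ_{j-1} ⋯ σ_{i+1})⁻¹`. -/
def pureGen {n : ℕ} (i j : Fin n) : PureBraidGroup n :=
  ⟨braidDescending n i j * braidSigma n i ^ 2 * (braidDescending n i j)⁻¹, by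
    rw [MonoidHom.mem_ker, map_mul, map_mul, map_inv, map_pow, braidPerm_sigma_sq, mul_one,
      mul_inv_cancel]⟩

/-- What remains of the crossing `i` of an `n`-strand braid when the strand that enters it in
position `k` is deleted: nothing if this strand takes part in the crossing, and otherwise a crossing
of the remaining `n - 1` strands, renumbered. -/
def remainingCrossing (n i k : ℕ) : BraidGroup (n - 1) :=
  if k = i ∨ k = i + 1 then 1 else if k < i then braidSigma (n - 1) (i - 1)
    else braidSigma (n - 1) i

/-- One step of strand deletion: multiply the braid on `n - 1` strands found so far by what remains
of the crossing `i`, and record the new position of the strand that is being deleted. -/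
def deletionStep {n : ℕ} (i : Fin (n - 1)) : Equiv.Perm (BraidGroup (n - 1) × Fin n) where
  toFun p := (remainingCrossing n i p.2 * p.1, adjSwap i p.2)
  invFun p := ((remainingCrossing n i (adjSwap i p.2))⁻¹ * p.1, adjSwap i p.2)
  left_inv p := by simp [adjSwap]
  right_inv p := by simp [adjSwap]

theorem deletionStep_braid {n : ℕ} (i j : Fin (n - 1)) (h : (i : ℕ) + 1 = j) :
    deletionStep i * deletionStep j * deletionStep i =
      deletionStep j * deletionStep i * deletionStep j := by
  ext1 ⟨b, k⟩
  obtain ⟨i, hi⟩ := i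
  obtain ⟨j, hj⟩ := j
  obtain ⟨k, hk⟩ := k
  simp only at h
  subst h
  refine Prod.ext ?_ ?_
  · simp only [Equiv.Perm.mul_apply, deletionStep, Equiv.coe_fn_mk, adjSwap_val, ← mul_assoc]
    congr 1
    have a2 : i ≠ i + 1 + 1 := by omega
    have a4 : ¬ i + 1 + 1 < i := by omega
    rcases eq_or_ne k i with rfl | h1
    · simp [remainingCrossing, a2, a2.symm, a4]
    rcases eq_or_ne k (i + 1) with rfl | h2
    · simp [remainingCrossing, a2, a2.symm, a4]
    rcases eq_or_ne k (i + 1 + 1) with rfl | h3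
    · simp [remainingCrossing, a2, a2.symm, a4]
    rcases lt_or_gt_of_ne h1 with h | h
    · obtain ⟨i, rfl⟩ : ∃ i', i = i' + 1 := ⟨i - 1, by omega⟩
      have e4 : k < i + 1 + 1 := by omega
      simp only [remainingCrossing, h1, h2, h3, h, e4, if_false, if_true, or_self,
        Nat.add_sub_cancel]
      exact braidSigma_braid _ _ (by omega)
    · have e3 : ¬ k < i := by omega
      have e4 : ¬ k < i + 1 := by omega
      simp only [remainingCrossing, h1, h2, h3, e3, e4, if_false, or_self]
      exact braidSigma_braid _ _ (by omega)
  · exact congrArg (fun s : Equiv.Perm (Fin n) => s ⟨k, hk⟩)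
      (adjSwap_braid ⟨i, hi⟩ ⟨i + 1, hj⟩ rfl)

theorem deletionStep_comm {n : ℕ} (i j : Fin (n - 1)) (h : (i : ℕ) + 2 ≤ j) :
    deletionStep i * deletionStep j = deletionStep j * deletionStep i := by
  ext1 ⟨b, k⟩
  obtain ⟨i, hi⟩ := i
  obtain ⟨j, hj⟩ := j
  obtain ⟨k, hk⟩ := k
  simp only at h
  refine Prod.ext ?_ ?_
  · simp only [Equiv.Perm.mul_apply, deletionStep, Equiv.coe_fn_mk, adjSwap_val, ← mul_assoc]
    congr 1
    unfold remainingCrossing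
    split_ifs <;> first
      | omega
      | simp
      | exact braidSigma_comm _ _ _ (by omega)
  · exact congrArg (fun s : Equiv.Perm (Fin n) => s ⟨k, hk⟩) (adjSwap_comm ⟨i, hi⟩ ⟨j, hj⟩ h)

/-- Strand deletion along a whole braid, its word being read from right to left. -/
def deletionAction (n : ℕ) : BraidGroup n →* Equiv.Perm (BraidGroup (n - 1) × Fin n) :=
  braidLift deletionStep deletionStep_braid deletionStep_comm

/-- The braid on `n - 1` strands that is left when the `k`-th strand of a pure braid is deleted. -/
def deleteStrand {n : ℕ} (k : Fin n) (b : PureBraidGroup n) : BraidGroup (n - 1) :=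
  (deletionAction n b (1, k)).1

/-- A pure braid is Brunnian if the deletion of any strand makes it trivial. -/
def IsBrunnian {n : ℕ} (b : PureBraidGroup n) : Prop := ∀ k : Fin n, deleteStrand k b = 1

/-- A group is residually free if every nontrivial element has a nontrivial image under some
homomorphism to a free group. -/
def ResiduallyFree.{u} (G : Type u) [Group G] : Prop :=
  ∀ x : G, x ≠ 1 → ∃ (α : Type u) (f : G →* FreeGroup α), f x ≠ 1

/-- The free group `F_2` of rank two. -/
abbrev FreeTwo : Type := FreeGroup (Fin 2)

/-- The first free generator of `F_2`. -/
def freeX : FreeTwo := FreeGroup.of 0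

/-- The second free generator of `F_2`. -/
def freeY : FreeTwo := FreeGroup.of 1

/-- The value of `f_I` on `A_{r,s}` for `I = {i < j < k}`. -/
def valueThree {n : ℕ} (i j k r s : Fin n) : FreeTwo :=
  if r = i ∧ s = j then freeX
  else if r = i ∧ s = k then freeY
  else if r = j ∧ s = k then freeY⁻¹ * freeX⁻¹
  else 1

/-- The value of `f_I` on `A_{r,s}` for `I = {i < j < k < l}`. -/
def valueFour {n : ℕ} (i j k l r s : Fin n) : FreeTwo :=
  if r = i ∧ s = j then freeX
  else if r = i ∧ s = k then freeY
  else if r = j ∧ s = k then freeY⁻¹ * freeX⁻¹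
  else if r = i ∧ s = l then freeY⁻¹ * freeX⁻¹
  else if r = j ∧ s = l then freeX * freeY * freeX⁻¹
  else if r = k ∧ s = l then freeX
  else 1

/-- `f` is the homomorphism `f_I : P_n → F_2` for `I = {i < j < k}`, given by its values on the
generators `A_{r,s}`. -/
def IsThreeStrandMap {n : ℕ} (i j k : Fin n) (f : PureBraidGroup n →* FreeTwo) : Prop :=
  ∀ r s : Fin n, r < s → f (pureGen r s) = valueThree i j k r s

/-- `f` is the homomorphism `f_I : P_n → F_2` for `I = {i < j < k < l}`, given by its values on the
generators `A_{r,s}`. -/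
def IsFourStrandMap {n : ℕ} (i j k l : Fin n) (f : PureBraidGroup n →* FreeTwo) : Prop :=
  ∀ r s : Fin n, r < s → f (pureGen r s) = valueFour i j k l r s

/-- The pure braid `[[A_{1,2}, A_{2,3}], [A_{2,3}, A_{3,4}]]` in `P_n`, where `n ≥ 4` and
`[u, v] = u v u⁻¹ v⁻¹`. In the code the strands are numbered from `0`. -/
def pureWitness (n : ℕ) (hn : 4 ≤ n) : PureBraidGroup n :=
  let A12 : PureBraidGroup n := pureGen ⟨0, by omega⟩ ⟨1, by omega⟩
  let A23 : PureBraidGroup n := pureGen ⟨1, by omega⟩ ⟨2, by omega⟩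
  let A34 : PureBraidGroup n := pureGen ⟨2, by omega⟩ ⟨3, by omega⟩
  ⁅⁅A12, A23⁆, ⁅A23, A34⁆⁆

/-! In a free group, two elements that commute with a common nontrivial element commute with each
other: a centralizer is free, and a free group of rank at least two has trivial centre. Number the
strands from 1. In `P_n`, A₁₄A₂₄A₃₄ commutes with A₁₂ and A₂₃, the full twist A₂₃A₂₄A₃₄ with A₂₃ and
A₃₄, and the full twist A₁₂A₁₄A₂₄ with A₁₂ and A₁₄. Under a homomorphism to a free group, w dies if
the images of A₁₂ and A₂₃, or those of A₂₃ and A₃₄, commute. Otherwise the first two products die,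
so A₁₄ and A₂₃ have the same image. Hence the third product dies too, A₁₂ and A₃₄ have the same
image, and the two inner commutators of w become inverse to each other
(`commutator_commutator_eq_one_of_commute`, `map_pureWitness_eq_one`).

Nontriviality of w is detected by the action of braids on Fox 3-colourings (`pureWitness_ne_one`).
For n = 4 each strand deletion kills A₁₂ or A₃₄, hence an inner commutator.

The map `f_I` is restriction to the strands in I, followed by the action of `B_3` on `F_2`, preceded
for |I| = 4 by the map `B_4 → B_3` identifying the outer generators. Pure generators act by inner
automorphisms, and `F_2` is centreless, so the values lift to `F_2`. This and uniqueness use that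
the A_{r,s} generate `P_n` (`closure_pureGen`): they generate a normal subgroup of `B_n` whose
quotient is a Coxeter quotient embedding in the symmetric group. -/

/-! ### Centralizers in free groups -/

namespace FreeGroup

/-- A free group with two different free generators has trivial centre. -/
theorem eq_one_of_forall_commute {ι : Type*} {a b : ι} (hab : a ≠ b) {z : FreeGroup ι}
    (hz : ∀ w, Commute z w) : z = 1 := by
  classical
  by_contra h
  have hne : z.toWord ≠ [] := fun h' => h (toWord_eq_nil_iff.1 h')
  have hred : IsReduced z.toWord := isReduced_toWord
  obtain ⟨p, T, hT⟩ := List.exists_cons_of_ne_nil hne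
  obtain ⟨j, hj⟩ : ∃ j, j ≠ p.1 := by
    rcases eq_or_ne a p.1 with h1 | h1
    · exact ⟨b, fun h2 => hab (h1.trans h2.symm)⟩
    · exact ⟨a, h1⟩
  -- The new letter cannot cancel on either side: its generator differs from that of the first
  -- letter, and its sign is that of the last letter. So both products are reduced as written, and
  -- their first letters differ.
  let t : ι × Bool := (j, (z.toWord.getLast hne).2)
  have e1 : (FreeGroup.mk [t] * z).toWord = t :: z.toWord := by
    rw [toWord_mul, toWord_mk, reduce_singleton, List.singleton_append]
    refine IsReduced.reduce_eq ?_
    rw [hT, isReduced_cons_cons]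
    exact ⟨fun h' => absurd h' hj, hT ▸ hred⟩
  have e2 : (z * FreeGroup.mk [t]).toWord = z.toWord ++ [t] := by
    rw [toWord_mul, toWord_mk, reduce_singleton]
    refine IsReduced.reduce_eq ?_
    refine List.IsChain.append hred (List.isChain_singleton _) ?_
    intro x hx y hy hxy
    rw [List.getLast?_eq_getLast_of_ne_nil hne, Option.mem_some_iff] at hx
    simp only [List.head?_cons, Option.mem_some_iff] at hy
    rw [← hx, ← hy]
  have e3 := congrArg toWord (hz (FreeGroup.mk [t])).eq
  rw [e1, e2, hT, List.cons_append, List.cons.injEq] at e3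
  exact hj (congrArg Prod.fst e3.1).symm

/-- In a free group, commutation is transitive on nontrivial elements. -/
theorem commute_of_commute_of_ne_one {ι : Type*} {z u v : FreeGroup ι} (hz : z ≠ 1)
    (hu : Commute z u) (hv : Commute z v) : Commute u v := by
  let C := Subgroup.centralizer ({z} : Set (FreeGroup ι))
  have mem : ∀ {w}, Commute z w → w ∈ C := fun h => Subgroup.mem_centralizer_singleton_iff.2 h.symm.eq
  -- The centralizer is free by Nielsen–Schreier. With at most one generator it is abelian; with two
  -- it has trivial centre, although it contains z centrally.
  let e := IsFreeGroup.toFreeGroup C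
  by_cases hs : Subsingleton (IsFreeGroup.Generators C)
  · have key : ∀ p q : FreeGroup (IsFreeGroup.Generators C), Commute p q := by
      intro p q
      induction q using FreeGroup.induction_on with
      | C1 => exact Commute.one_right p
      | of a =>
        induction p using FreeGroup.induction_on with
        | C1 => exact Commute.one_left _
        | of b => rw [Subsingleton.elim a b]
        | inv_of b h => exact h.inv_left
        | mul x y hx hy => exact hx.mul_left hy
      | inv_of a h => exact h.inv_right
      | mul x y hx hy => exact hx.mul_right hy
    have h1 : (⟨u, mem hu⟩ : C) * ⟨v, mem hv⟩ = ⟨v, mem hv⟩ * ⟨u, mem hu⟩ := by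
      apply e.injective
      rw [_root_.map_mul, _root_.map_mul]
      exact key _ _
    exact congrArg Subtype.val h1
  · rw [not_subsingleton_iff_nontrivial] at hs
    obtain ⟨a, b, hab⟩ := hs
    refine absurd ?_ hz
    have h1 : e ⟨z, mem (Commute.refl z)⟩ = 1 := by
      refine eq_one_of_forall_commute hab fun w => ?_
      obtain ⟨⟨c, hc⟩, rfl⟩ := e.surjective w
      change e _ * e _ = e _ * e _
      rw [← _root_.map_mul, ← _root_.map_mul]
      congr 1
      exact Subtype.ext (Subgroup.mem_centralizer_singleton_iff.1 hc).symm
    rw [map_eq_one_iff e e.injective] at h1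
    exact congrArg Subtype.val h1

end FreeGroup

theorem conj_injective_freeTwo : Function.Injective (MulAut.conj : FreeTwo →* MulAut FreeTwo) := by
  rw [injective_iff_map_eq_one]
  intro z hz
  refine FreeGroup.eq_one_of_forall_commute (a := (0 : Fin 2)) (b := 1) (by decide) fun w => ?_
  have := DFunLike.congr_fun hz w
  rw [MulAut.conj_apply, MulAut.one_apply] at this
  exact mul_inv_eq_iff_eq_mul.1 this

theorem Subgroup.conj_mem_of_sq_mem {G : Type*} [Group G] {N : Subgroup G} {s : G}
    (hs : s ^ 2 ∈ N) (h : ∀ x ∈ N, s * x * s⁻¹ ∈ N) {x : G} (hx : x ∈ N) : s⁻¹ * x * s ∈ N := by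
  have h1 : s⁻¹ * x * s = (s ^ 2)⁻¹ * (s * x * s⁻¹) * s ^ 2 := by group
  rw [h1]
  exact N.mul_mem (N.mul_mem (N.inv_mem hs) (h x hx)) hs

/-- Six elements of a free group with the commutation relations that the images of the generators
of `P_4` satisfy. -/
theorem commutator_commutator_eq_one_of_commute {α : Type*} {a c d e g : FreeGroup α}
    (h1 : Commute (d * e * g) a) (h2 : Commute (d * e * g) c) (h3 : Commute (c * e * g) c)
    (h4 : Commute (c * e * g) g) (h5 : Commute (a * d * e) a) (h6 : Commute (a * d * e) d) :
    ⁅⁅a, c⁆, ⁅c, g⁆⁆ = 1 := by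
  by_cases hac : Commute a c
  · rw [commutatorElement_eq_one_iff_commute.2 hac, commutatorElement_one_left]
  by_cases hcg : Commute c g
  · rw [commutatorElement_eq_one_iff_commute.2 hcg, commutatorElement_one_right]
  -- An element commuting with both members of a noncommuting pair is trivial. The same argument
  -- gives `e2`, and `e3` once d and c are identified.
  have e1 : d * e * g = 1 := by
    by_contra h
    exact hac (FreeGroup.commute_of_commute_of_ne_one h h1 h2)
  have e2 : c * e * g = 1 := by
    by_contra h
    exact hcg (FreeGroup.commute_of_commute_of_ne_one h h3 h4)
  obtain rfl : d = c := by
    rw [← e2] at e1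
    exact mul_right_cancel (mul_right_cancel e1)
  have e3 : a * d * e = 1 := by
    by_contra h
    exact hac (FreeGroup.commute_of_commute_of_ne_one h h5 h6)
  obtain rfl : g = a := by
    rw [mul_assoc] at e3
    rw [← inv_eq_of_mul_eq_one_right e2, inv_eq_of_mul_eq_one_left e3]
  -- After the identifications the two inner commutators are ⁅g, d⁆ and its inverse.
  rw [commutatorElement_eq_one_iff_commute, ← commutatorElement_inv g d]
  exact (Commute.refl _).inv_right

/-! ### Conjugation of the pure generators by the braid generators -/

/-- The element `s_{r+m} ⋯ s_{r+1} s_r² s_{r+1}⁻¹ ⋯ s_{r+m}⁻¹`, the analogue of `A_{r, r+m+1}` for a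
sequence `s` of elements of a group. -/
def stdPure {G : Type*} [Group G] (s : ℕ → G) (r : ℕ) : ℕ → G
  | 0 => s r ^ 2
  | m + 1 => s (r + m + 1) * stdPure s r m * (s (r + m + 1))⁻¹

/-- The product `s_{j+l-1} ⋯ s_j`. -/
def descProd {G : Type*} [Group G] (s : ℕ → G) (j : ℕ) : ℕ → G
  | 0 => 1
  | l + 1 => s (j + l) * descProd s j l

theorem Commute.conj_conj {G : Type*} [Group G] {a b : G} (h : Commute a b) (g : G) :
    Commute (g * a * g⁻¹) (g * b * g⁻¹) := by
  simpa using h.map (MulAut.conj g)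

/-- The first `N` terms of the sequence `s` satisfy the braid relations, and all terms satisfy the
far commutation relations. -/
structure IsBraided {G : Type*} [Group G] (s : ℕ → G) (N : ℕ) : Prop where
  braid : ∀ i, i + 1 < N → s i * s (i + 1) * s i = s (i + 1) * s i * s (i + 1)
  comm : ∀ i j, i + 2 ≤ j → Commute (s i) (s j)

theorem isBraided_braidSigma (n : ℕ) : IsBraided (braidSigma n) (n - 1) :=
  ⟨braidSigma_braid n, braidSigma_comm n⟩

namespace IsBraided

variable {G : Type*} [Group G] {s : ℕ → G} {N : ℕ}

theorem map {H : Type*} [Group H] (hs : IsBraided s N) (f : G →* H) :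
    IsBraided (fun i => f (s i)) N :=
  ⟨fun i hi => by simp only [← map_mul, hs.braid i hi], fun i j h => (hs.comm i j h).map f⟩

theorem conj_succ (hs : IsBraided s N) {i : ℕ} (hi : i + 1 < N) :
    s i * s (i + 1) * s i * (s i * s (i + 1))⁻¹ = s (i + 1) := by
  rw [hs.braid i hi]
  group

theorem conj_pred (hs : IsBraided s N) {i : ℕ} (hi : i + 1 < N) :
    s (i + 1) * s i * s (i + 1) * (s (i + 1) * s i)⁻¹ = s i := by
  rw [← hs.braid i hi]
  group

theorem commute_stdPure_of_lt (hs : IsBraided s N) {k r : ℕ} (h : k + 2 ≤ r) (m : ℕ) :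
    Commute (s k) (stdPure s r m) := by
  induction m with
  | zero => exact (hs.comm k r h).pow_right 2
  | succ m ih =>
    have := hs.comm k (r + m + 1) (by omega)
    exact (this.mul_right ih).mul_right this.inv_right

theorem commute_stdPure_of_gt (hs : IsBraided s N) {k r m : ℕ} (h : r + m + 2 ≤ k) :
    Commute (s k) (stdPure s r m) := by
  induction m with
  | zero => exact (hs.comm r k (by omega)).symm.pow_right 2
  | succ m ih =>
    have := (hs.comm (r + m + 1) k (by omega)).symm
    exact (this.mul_right (ih (by omega))).mul_right this.inv_right

/-- For l = 0, conjugation by s_{r+m+2} s_{r+m+1} carries s_{r+m+2}, which is far from the shorter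
generator, to s_{r+m+1}, and the shorter generator to the longer one. Later factors are far from
s_{r+m+1}. -/
theorem commute_stdPure_of_mem (hs : IsBraided s N) {r m l : ℕ} (h : r + m + l + 2 < N) :
    Commute (s (r + m + 1)) (stdPure s r (m + 2 + l)) := by
  induction l with
  | zero =>
    have h1 := (hs.commute_stdPure_of_gt (r := r) (m := m) (k := r + m + 2) le_rfl).conj_conj
      (s (r + m + 1 + 1) * s (r + m + 1))
    rw [hs.conj_pred (by omega)] at h1
    convert h1 using 1
    simp only [stdPure, mul_inv_rev, mul_assoc, add_assoc]
  | succ l ih =>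
    have := hs.comm (r + m + 1) (r + (m + 2 + l) + 1) (by omega)
    exact (this.mul_right (ih (by omega))).mul_right this.inv_right

theorem conj_stdPure_self (hs : IsBraided s N) {r m : ℕ} (h : r + m + 1 < N) :
    s r * stdPure s r (m + 1) * (s r)⁻¹ = stdPure s (r + 1) m := by
  induction m with
  | zero =>
    have h1 := congrArg (· ^ 2) (hs.conj_succ (i := r) (by omega))
    simp only [conj_pow] at h1
    simp only [stdPure, ← h1, mul_inv_rev, mul_assoc, Nat.add_zero]
  | succ m ih =>
    have h1 := hs.comm r (r + (m + 1) + 1) (by omega)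
    have h2 : r + 1 + m + 1 = r + (m + 1) + 1 := by omega
    change s r * (s (r + (m + 1) + 1) * stdPure s r (m + 1) * (s (r + (m + 1) + 1))⁻¹) * (s r)⁻¹ =
      s (r + 1 + m + 1) * stdPure s (r + 1) m * (s (r + 1 + m + 1))⁻¹
    rw [← ih (by omega), h2]
    simp only [← mul_assoc]
    rw [h1.eq]
    simp only [mul_assoc]
    rw [← mul_inv_rev, h1.eq, mul_inv_rev]

theorem conj_stdPure_succ (hs : IsBraided s N) {r m : ℕ} (h : r + m + 1 < N) :
    s r * stdPure s (r + 1) m * (s r)⁻¹ =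
      stdPure s r 0 * stdPure s r (m + 1) * (stdPure s r 0)⁻¹ := by
  rw [← hs.conj_stdPure_self h, stdPure, pow_two]
  group

/-- The subgroup that the elements `stdPure s r m` generate is stable under conjugation by the
elements of the sequence. -/
theorem conj_mem_closure_stdPure (hs : IsBraided s N) {k : ℕ} (hk : k < N) {x : G}
    (hx : x ∈ Subgroup.closure {y | ∃ r m, r + m < N ∧ y = stdPure s r m}) :
    s k * x * (s k)⁻¹ ∈ Subgroup.closure {y | ∃ r m, r + m < N ∧ y = stdPure s r m} := by
  set K := Subgroup.closure {y | ∃ r m, r + m < N ∧ y = stdPure s r m} with hK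
  have mem : ∀ r m, r + m < N → stdPure s r m ∈ K := fun r m h =>
    Subgroup.subset_closure ⟨r, m, h, rfl⟩
  have comm : ∀ r m, r + m < N → Commute (s k) (stdPure s r m) →
      s k * stdPure s r m * (s k)⁻¹ ∈ K := fun r m h h' => by
    rw [h'.eq, mul_inv_cancel_right]
    exact mem r m h
  induction hx using Subgroup.closure_induction with
  | one => simp
  | mul x y _ _ hx hy =>
    have := K.mul_mem hx hy
    rwa [conj_mul] at this
  | inv x _ hx =>
    have := K.inv_mem hx
    rwa [conj_inv] at this
  | mem x hx =>
    obtain ⟨r, m, h, rfl⟩ := hx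
    -- The generator joins the positions r and r + m + 1, so only k = r - 1, r, r + m, r + m + 1 can
    -- move an end. Each such move gives another generator, possibly conjugated by a square, or for
    -- m = 0 and k = r the same one.
    rcases lt_trichotomy k r with h1 | rfl | h1
    · rcases Nat.lt_or_ge (k + 1) r with h2 | h2
      · exact comm r m h (hs.commute_stdPure_of_lt h2 m)
      · obtain rfl : r = k + 1 := by omega
        rw [hs.conj_stdPure_succ (by omega)]
        exact K.mul_mem (K.mul_mem (mem _ _ (by omega)) (mem _ _ (by omega)))
          (K.inv_mem (mem _ _ (by omega)))
    · cases m with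
      | zero => exact comm k 0 h ((Commute.refl _).pow_right 2)
      | succ m =>
        rw [hs.conj_stdPure_self (by omega)]
        exact mem _ _ (by omega)
    · rcases lt_trichotomy k (r + m) with h2 | rfl | h2
      · obtain ⟨a, rfl⟩ : ∃ a, k = r + a + 1 := ⟨k - r - 1, by omega⟩
        obtain ⟨l, rfl⟩ : ∃ l, m = a + 2 + l := ⟨m - (a + 2), by omega⟩
        exact comm _ _ h (hs.commute_stdPure_of_mem (by omega))
      · obtain ⟨m, rfl⟩ : ∃ a, m = a + 1 := ⟨m - 1, by omega⟩
        have h3 : s (r + (m + 1)) * stdPure s r (m + 1) * (s (r + (m + 1)))⁻¹ =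
            stdPure s (r + m + 1) 0 * stdPure s r m * (stdPure s (r + m + 1) 0)⁻¹ := by
          rw [stdPure, stdPure, pow_two, ← add_assoc]
          group
        rw [h3]
        exact K.mul_mem (K.mul_mem (mem _ _ (by omega)) (mem _ _ (by omega)))
          (K.inv_mem (mem _ _ (by omega)))
      · rcases Nat.lt_or_ge (r + m + 1) k with h3 | h3
        · exact comm _ _ h (hs.commute_stdPure_of_gt h3)
        · obtain rfl : k = r + m + 1 := by omega
          exact mem r (m + 1) (by omega)

/-! ### The Coxeter presentation of the symmetric group -/

theorem descProd_succ' (s : ℕ → G) (j l : ℕ) :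
    descProd s j (l + 1) = descProd s (j + 1) l * s j := by
  induction l with
  | zero => simp [descProd]
  | succ l ih =>
    rw [descProd, ih, descProd, mul_assoc]
    congr 2
    omega

theorem descProd_commute_of_lt (hs : IsBraided s N) {i j : ℕ} (h : i + 2 ≤ j) (l : ℕ) :
    Commute (s i) (descProd s j l) := by
  induction l with
  | zero => exact Commute.one_right _
  | succ l ih => exact (hs.comm i (j + l) (by omega)).mul_right ih

theorem descProd_commute_of_gt (hs : IsBraided s N) {i j l : ℕ} (h : j + l < i) :
    Commute (s i) (descProd s j l) := by
  induction l with
  | zero => exact Commute.one_right _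
  | succ l ih => exact (hs.comm (j + l) i (by omega)).symm.mul_right (ih (by omega))

/-- The factors below s_i commute with s_{i+1}, the braid relation turns s_{i+1} s_i s_{i+1} into
s_i s_{i+1} s_i, and the factors above s_{i+1} commute with s_i. -/
theorem descProd_mul (hs : IsBraided s N) {i j l : ℕ} (h1 : j ≤ i) (h2 : i + 1 < j + l)
    (hN : i + 1 < N) : descProd s j l * s (i + 1) = s i * descProd s j l := by
  induction l with
  | zero => omega
  | succ l ih =>
    rcases Nat.lt_or_ge (i + 1) (j + l) with h3 | h3
    · rw [descProd, mul_assoc, ih h3, ← mul_assoc, ← mul_assoc, (hs.comm i (j + l) (by omega)).eq]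
    · obtain ⟨l, rfl⟩ : ∃ l', l = l' + 1 := ⟨l - 1, by omega⟩
      obtain rfl : i = j + l := by omega
      rw [descProd, descProd, ← add_assoc, ← mul_assoc, mul_assoc,
        ← (hs.descProd_commute_of_gt (i := j + l + 1) (by omega)).eq, ← mul_assoc,
        ← hs.braid _ hN]
      simp only [mul_assoc]

/-- In a quotient of the braid group by the squares of the generators, every element of the subgroup
generated by the first `k + 1` generators is the product of an element of the subgroup generated by
the first `k` generators and a descending product. -/
theorem exists_eq_mul_descProd (hs : IsBraided s N) (h2 : ∀ i, s i * s i = 1) {k : ℕ}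
    (hk : k < N) {q : G} (hq : q ∈ Subgroup.closure (s '' Set.Iio (k + 1))) :
    ∃ h ∈ Subgroup.closure (s '' Set.Iio k), ∃ j l, j + l = k + 1 ∧ q = h * descProd s j l := by
  have step : ∀ h ∈ Subgroup.closure (s '' Set.Iio k), ∀ j l, j + l = k + 1 → ∀ i < k + 1,
      ∃ h' ∈ Subgroup.closure (s '' Set.Iio k), ∃ j' l', j' + l' = k + 1 ∧
        h * descProd s j l * s i = h' * descProd s j' l' := by
    intro h hh j l hjl i hi
    have mem : ∀ t < k, s t ∈ Subgroup.closure (s '' Set.Iio k) := fun t ht =>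
      Subgroup.subset_closure ⟨t, ht, rfl⟩
    -- Right multiplication by s_i passes through the product if i < j - 1, lengthens it if i = j -
    -- 1, shortens it if i = j, and emerges on its left as s_{i-1} if i > j.
    rcases lt_trichotomy i j with h3 | rfl | h3
    · rcases Nat.lt_or_ge (i + 1) j with h4 | h4
      · exact ⟨h * s i, Subgroup.mul_mem _ hh (mem i (by omega)), j, l, hjl, by
          rw [mul_assoc, ← (hs.descProd_commute_of_lt h4 l).eq, mul_assoc]⟩
      · obtain rfl : j = i + 1 := by omega
        exact ⟨h, hh, i, l + 1, by omega, by rw [descProd_succ', mul_assoc]⟩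
    · obtain ⟨l, rfl⟩ : ∃ l', l = l' + 1 := ⟨l - 1, by omega⟩
      exact ⟨h, hh, i + 1, l, by omega, by
        rw [descProd_succ', mul_assoc, mul_assoc, h2, mul_one]⟩
    · obtain ⟨i, rfl⟩ : ∃ i', i = i' + 1 := ⟨i - 1, by omega⟩
      exact ⟨h * s i, Subgroup.mul_mem _ hh (mem i (by omega)), j, l, hjl, by
        rw [mul_assoc, hs.descProd_mul (by omega) (by omega) (by omega), mul_assoc]⟩
  induction hq using Subgroup.closure_induction_right with
  | one => exact ⟨1, Subgroup.one_mem _, k + 1, 0, rfl, by simp [descProd]⟩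
  | mul_right x _ y hy ih =>
    obtain ⟨i, hi, rfl⟩ := hy
    obtain ⟨h, hh, j, l, hjl, rfl⟩ := ih
    exact step h hh j l hjl i hi
  | mul_inv_cancel x _ y hy ih =>
    obtain ⟨i, hi, rfl⟩ := hy
    obtain ⟨h, hh, j, l, hjl, rfl⟩ := ih
    rw [inv_eq_of_mul_eq_one_right (h2 i)]
    exact step h hh j l hjl i hi

theorem apply_descProd {n : ℕ} {s : ℕ → G} (π : G →* Equiv.Perm (Fin n))
    (hπ : ∀ i : Fin (n - 1), π (s i) = adjSwap i) {j l : ℕ} (h : j + l < n) :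
    π (descProd s j l) ⟨j, by omega⟩ = ⟨j + l, h⟩ := by
  induction l with
  | zero => simp [descProd]
  | succ l ih =>
    rw [descProd, map_mul, Equiv.Perm.mul_apply, ih (by omega), hπ ⟨j + l, by omega⟩]
    ext
    simp [adjSwap_val, add_assoc]

theorem apply_of_lt {n : ℕ} {s : ℕ → G} (π : G →* Equiv.Perm (Fin n))
    (hπ : ∀ i : Fin (n - 1), π (s i) = adjSwap i) {k : ℕ} (hk : k ≤ n - 1) {q : G}
    (hq : q ∈ Subgroup.closure (s '' Set.Iio k)) (p : Fin n) (hp : k < p) : π q p = p := by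
  have : Subgroup.closure (s '' Set.Iio k) ≤
      (MulAction.stabilizer (Equiv.Perm (Fin n)) p).comap π := by
    rw [Subgroup.closure_le]
    rintro _ ⟨i, hi, rfl⟩
    rw [Set.mem_Iio] at hi
    have h1 : π (s i) p = p := by
      rw [hπ ⟨i, by omega⟩]
      ext
      rw [adjSwap_val, if_neg (by simp; omega), if_neg (by simp; omega)]
    exact h1
  exact this hq

/-- The Coxeter presentation of the symmetric group: a group generated by involutions that satisfy
the braid relations embeds into the symmetric group. -/
theorem eq_one_of_perm_eq_one {n : ℕ} {s : ℕ → G} (hs : IsBraided s (n - 1))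
    (h2 : ∀ i, s i * s i = 1) (π : G →* Equiv.Perm (Fin n))
    (hπ : ∀ i : Fin (n - 1), π (s i) = adjSwap i) {k : ℕ} (hk : k ≤ n - 1) {q : G}
    (hq : q ∈ Subgroup.closure (s '' Set.Iio k)) (h1 : π q = 1) : q = 1 := by
  induction k generalizing q with
  | zero => simpa using hq
  | succ k ih =>
    obtain ⟨h, hh, j, l, hjl, rfl⟩ := hs.exists_eq_mul_descProd h2 (by omega) hq
    -- The descending product sends position j to k + 1, which h fixes. Since the whole permutation
    -- is trivial, j = k + 1 and the product is empty.
    have e := congrArg (fun p : Equiv.Perm (Fin n) => p ⟨j, by omega⟩) h1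
    simp only [map_mul, Equiv.Perm.mul_apply, Equiv.Perm.one_apply] at e
    rw [apply_descProd π hπ (by omega), apply_of_lt π hπ (by omega) hh _ (by simp; omega)] at e
    obtain rfl : l = 0 := by simpa using e
    rw [descProd, mul_one] at h1 ⊢
    exact ih (by omega) hh h1

end IsBraided

/-! ### Generation of the pure braid group -/

theorem braidPerm_of {n : ℕ} (i : Fin (n - 1)) : braidPerm n (braidSigma n i) = adjSwap i := by
  rw [braidSigma, dif_pos i.2]
  exact braidLift_of ..

theorem closure_braidSigma (n : ℕ) :
    Subgroup.closure (braidSigma n '' Set.Iio (n - 1)) = ⊤ := by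
  rw [← PresentedGroup.closure_range_of (braidRelations n)]
  congr 1
  ext x
  constructor
  · rintro ⟨i, hi, rfl⟩
    exact ⟨⟨i, hi⟩, by rw [braidSigma, dif_pos (Set.mem_Iio.1 hi)]⟩
  · rintro ⟨i, rfl⟩
    exact ⟨i, i.2, by rw [braidSigma, dif_pos i.2]⟩

theorem coe_pureGen {n : ℕ} {i j : Fin n} {m : ℕ} (h : (i : ℕ) + m + 1 = j) :
    (pureGen i j : BraidGroup n) = stdPure (braidSigma n) i m := by
  have key : ∀ m : ℕ, ((List.range' ((i : ℕ) + 1) m).reverse.map (braidSigma n)).prod *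
      braidSigma n i ^ 2 * (((List.range' ((i : ℕ) + 1) m).reverse.map (braidSigma n)).prod)⁻¹ =
      stdPure (braidSigma n) i m := by
    intro m
    induction m with
    | zero => simp [stdPure]
    | succ m ih =>
      rw [stdPure, ← ih, List.range'_concat]
      have : (i : ℕ) + 1 + 1 * m = i + m + 1 := by ring
      simp only [List.reverse_append, List.reverse_singleton, List.map_append,
        List.map_cons, List.map_nil, List.prod_append, List.prod_singleton, mul_inv_rev,
        mul_assoc, this]
  obtain rfl : (j : ℕ) - 1 - i = m := by omega
  exact key _

/-- The kernel of `B_n → Σ_n` is generated by the elements `A_{i,j}`. -/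
theorem ker_braidPerm (n : ℕ) : (braidPerm n).ker ≤
    Subgroup.closure {y | ∃ r m, r + m < n - 1 ∧ y = stdPure (braidSigma n) r m} := by
  set K := Subgroup.closure {y | ∃ r m, r + m < n - 1 ∧ y = stdPure (braidSigma n) r m} with hK
  have hs := isBraided_braidSigma n
  have sq : ∀ k, braidSigma n k ^ 2 ∈ K := by
    intro k
    by_cases hk : k < n - 1
    · exact Subgroup.subset_closure ⟨k, 0, hk, rfl⟩
    · simp [braidSigma, dif_neg hk]
  have norm : Subgroup.normalizer (K : Set (BraidGroup n)) = ⊤ := by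
    rw [eq_top_iff, ← closure_braidSigma, Subgroup.closure_le]
    rintro _ ⟨k, hk, rfl⟩
    refine Subgroup.mem_normalizer_iff.2 fun x => ⟨hs.conj_mem_closure_stdPure hk, fun hx => ?_⟩
    have := Subgroup.conj_mem_of_sq_mem (sq k) (fun x => hs.conj_mem_closure_stdPure hk) hx
    convert this using 1
    group
  have : K.Normal := Subgroup.normalizer_eq_top_iff.1 norm
  have hker : K ≤ (braidPerm n).ker := by
    rw [Subgroup.closure_le]
    rintro _ ⟨r, m, h, rfl⟩
    rw [← coe_pureGen (i := ⟨r, by omega⟩) (j := ⟨r + m + 1, by omega⟩) rfl]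
    exact Subtype.property _
  intro b hb
  -- In the quotient by K the generators are braided involutions, so the induced map to the
  -- symmetric group is injective.
  rw [← QuotientGroup.eq_one_iff]
  refine IsBraided.eq_one_of_perm_eq_one (hs.map (QuotientGroup.mk' K)) (fun i => ?_)
    (QuotientGroup.lift K (braidPerm n) hker) (fun i => braidPerm_of i) le_rfl ?_ hb
  · rw [← map_mul, ← pow_two]
    exact (QuotientGroup.eq_one_iff _).2 (sq i)
  · have h1 : (b : BraidGroup n ⧸ K) ∈
        (Subgroup.closure (braidSigma n '' Set.Iio (n - 1))).map (QuotientGroup.mk' K) := by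
      rw [closure_braidSigma]
      exact ⟨b, trivial, rfl⟩
    rwa [MonoidHom.map_closure, Set.image_image] at h1

/-- The pure braid group is generated by the elements `A_{r,s}`. -/
theorem closure_pureGen (n : ℕ) :
    Subgroup.closure {y : PureBraidGroup n | ∃ r s : Fin n, r < s ∧ y = pureGen r s} = ⊤ := by
  rw [eq_top_iff]
  intro b _
  have h1 := ker_braidPerm n b.2
  have h2 : {y | ∃ r m, r + m < n - 1 ∧ y = stdPure (braidSigma n) r m} ⊆
      (braidPerm n).ker.subtype '' {y | ∃ r s : Fin n, r < s ∧ y = pureGen r s} := by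
    rintro _ ⟨r, m, h, rfl⟩
    exact ⟨_, ⟨⟨r, by omega⟩, ⟨r + m + 1, by omega⟩, by rw [Fin.lt_def]; simp, rfl⟩,
      coe_pureGen rfl⟩
  have h3 := Subgroup.closure_mono h2 h1
  rw [← MonoidHom.map_closure] at h3
  obtain ⟨c, hc, e⟩ := h3
  rwa [← Subtype.ext (show (c : BraidGroup n) = b from e)]

/-! ### Restriction to a subset of the strands -/

/-- The subset of `ℕ` that results from `S` under the transposition of `p` and `p + 1`. -/
def swapSubset (p : ℕ) (S : ℕ → Bool) : ℕ → Bool := fun t => S (Equiv.swap p (p + 1) t)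

theorem swapSubset_left (p : ℕ) (S : ℕ → Bool) : swapSubset p S p = S (p + 1) := by
  simp [swapSubset]

theorem swapSubset_right (p : ℕ) (S : ℕ → Bool) : swapSubset p S (p + 1) = S p := by
  simp [swapSubset]

theorem swapSubset_of_ne {p t : ℕ} (S : ℕ → Bool) (h1 : t ≠ p) (h2 : t ≠ p + 1) :
    swapSubset p S t = S t := by
  simp [swapSubset, Equiv.swap_apply_of_ne_of_ne h1 h2]

theorem swapSubset_swapSubset (p : ℕ) (S : ℕ → Bool) : swapSubset p (swapSubset p S) = S := by
  funext t
  simp [swapSubset]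

theorem swapSubset_braid (p : ℕ) (S : ℕ → Bool) :
    swapSubset p (swapSubset (p + 1) (swapSubset p S)) =
      swapSubset (p + 1) (swapSubset p (swapSubset (p + 1) S)) := by
  funext t
  simp only [swapSubset, Equiv.swap_apply_def]
  congr 1
  split_ifs <;> omega

theorem swapSubset_comm {p q : ℕ} (h : p + 2 ≤ q) (S : ℕ → Bool) :
    swapSubset p (swapSubset q S) = swapSubset q (swapSubset p S) := by
  funext t
  simp only [swapSubset, Equiv.swap_apply_def]
  congr 1
  split_ifs <;> omega

/-- The number of elements of `S` below `k`. -/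
abbrev rankIn (S : ℕ → Bool) (k : ℕ) : ℕ := Nat.count (fun t => S t = true) k

/-- The count below k changes only if k separates the two exchanged positions. -/
theorem rankIn_swapSubset {p k : ℕ} (S : ℕ → Bool) (h : k ≠ p + 1) :
    rankIn (swapSubset p S) k = rankIn S k := by
  induction k using Nat.strong_induction_on with
  | _ k ih =>
    cases k with
    | zero => simp [rankIn]
    | succ k =>
      by_cases hk : k = p + 1
      · subst hk
        have e := ih p (by omega) (by omega)
        simp only [rankIn, Nat.count_succ, swapSubset_left, swapSubset_right] at e ⊢
        rw [e]
        omega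
      · have e := ih k (by omega) hk
        simp only [rankIn, Nat.count_succ] at e ⊢
        rw [e, swapSubset_of_ne S (by omega) hk]

section Restriction

variable {G : Type*} [Group G]

/-- What remains of the crossing `p` if all strands outside `S` are deleted: nothing unless both
strands that take part in it are in `S`, and otherwise a crossing of the remaining `M` strands,
which is replaced by a term of the sequence `g`. -/
def restrictedCrossing (g : ℕ → G) (n M p : ℕ) (S : ℕ → Bool) : G :=
  if S p = true ∧ S (p + 1) = true ∧ rankIn S n = M then g (rankIn S p) else 1

/-- One step of the deletion of all strands outside a subset. -/
def restrictionStep (g : ℕ → G) (n M p : ℕ) : Equiv.Perm (G × (ℕ → Bool)) where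
  toFun x := (restrictedCrossing g n M p x.2 * x.1, swapSubset p x.2)
  invFun x := ((restrictedCrossing g n M p (swapSubset p x.2))⁻¹ * x.1, swapSubset p x.2)
  left_inv x := by simp [swapSubset_swapSubset]
  right_inv x := by simp [swapSubset_swapSubset]

variable {g : ℕ → G} {n M : ℕ}

theorem restrictionStep_braid (hg : IsBraided g (M - 1)) {p : ℕ} (hp : p + 2 < n) :
    restrictionStep g n M p * restrictionStep g n M (p + 1) * restrictionStep g n M p =
      restrictionStep g n M (p + 1) * restrictionStep g n M p * restrictionStep g n M (p + 1) := by
  ext1 ⟨x, S⟩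
  refine Prod.ext ?_ (swapSubset_braid p S)
  simp only [Equiv.Perm.mul_apply, restrictionStep, Equiv.coe_fn_mk, ← mul_assoc]
  congr 1
  have n1 : n ≠ p + 1 := by omega
  have n2 : n ≠ p + 1 + 1 := by omega
  have a1 : p ≠ p + 1 + 1 := by omega
  have a2 : p ≠ p + 1 := by omega
  have b1 : ∀ T : ℕ → Bool, swapSubset (p + 1) T p = T p := fun T => swapSubset_of_ne T a2 a1
  have b2 : ∀ T : ℕ → Bool, swapSubset p T (p + 1 + 1) = T (p + 1 + 1) := fun T =>
    swapSubset_of_ne T a1.symm (by omega)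
  have c1 : ∀ T : ℕ → Bool, rankIn T (p + 1) = rankIn T p + if T p = true then 1 else 0 :=
    fun T => Nat.count_succ ..
  -- For a subset of the wrong size all crossings are trivial by convention. For the right size,
  -- three adjacent surviving strands keep the index within the range where `g` satisfies the braid
  -- relation.
  by_cases hM : rankIn S n = M
  swap
  · simp [restrictedCrossing, rankIn_swapSubset _ n1, rankIn_swapSubset _ n2, hM]
  simp only [restrictedCrossing, rankIn_swapSubset _ n1, rankIn_swapSubset _ n2, hM, c1,
    rankIn_swapSubset _ a2, rankIn_swapSubset _ a1, b1, b2, swapSubset_left, swapSubset_right]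
  cases h0 : S p <;> cases h1 : S (p + 1) <;> cases h2 : S (p + 1 + 1) <;> simp
  have h3 : rankIn S (p + 1 + 1 + 1) = rankIn S p + 1 + 1 + 1 := by
    simp [rankIn, Nat.count_succ, h0, h1, h2]
  have h4 : rankIn S (p + 1 + 1 + 1) ≤ rankIn S n := Nat.count_monotone _ (by omega)
  exact hg.braid _ (by omega)

theorem restrictionStep_comm (hg : IsBraided g (M - 1)) {p q : ℕ} (h : p + 2 ≤ q) (hq : q + 1 < n) :
    restrictionStep g n M p * restrictionStep g n M q =
      restrictionStep g n M q * restrictionStep g n M p := by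
  ext1 ⟨x, S⟩
  refine Prod.ext ?_ (swapSubset_comm h S)
  simp only [Equiv.Perm.mul_apply, restrictionStep, Equiv.coe_fn_mk, ← mul_assoc]
  congr 1
  have e1 : restrictedCrossing g n M p (swapSubset q S) = restrictedCrossing g n M p S := by
    simp only [restrictedCrossing]
    rw [rankIn_swapSubset S (show n ≠ q + 1 by omega),
      rankIn_swapSubset S (show p ≠ q + 1 by omega),
      swapSubset_of_ne (t := p) S (by omega) (by omega),
      swapSubset_of_ne (t := p + 1) S (by omega) (by omega)]
  have e2 : restrictedCrossing g n M q (swapSubset p S) = restrictedCrossing g n M q S := by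
    simp only [restrictedCrossing]
    rw [rankIn_swapSubset S (show n ≠ p + 1 by omega),
      rankIn_swapSubset S (show q ≠ p + 1 by omega),
      swapSubset_of_ne (t := q) S (by omega) (by omega),
      swapSubset_of_ne (t := q + 1) S (by omega) (by omega)]
  rw [e1, e2]
  unfold restrictedCrossing
  split_ifs with h1 h2
  · refine (hg.comm _ _ ?_).eq
    -- Both strands of the crossing p survive, so the renumbered crossings are still at distance at
    -- least two.
    have h3 : rankIn S (p + 1 + 1) = rankIn S p + 1 + 1 := by
      simp [rankIn, Nat.count_succ, h1.1, h1.2.1]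
    have h4 : rankIn S (p + 1 + 1) ≤ rankIn S q := Nat.count_monotone _ h
    omega
  all_goals simp

/-- Deletion of all strands outside a subset, along a whole braid. -/
def restrictionAction (n : ℕ) (hg : IsBraided g (M - 1)) :
    BraidGroup n →* Equiv.Perm (G × (ℕ → Bool)) :=
  braidLift (fun i => restrictionStep g n M i)
    (fun i j h => by
      obtain ⟨j, hj⟩ := j
      subst h
      exact restrictionStep_braid hg (by omega))
    (fun i j h => restrictionStep_comm hg h (by omega))

theorem restrictionAction_sigma (hg : IsBraided g (M - 1)) {p : ℕ} (hp : p + 1 < n) :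
    restrictionAction n hg (braidSigma n p) = restrictionStep g n M p := by
  rw [braidSigma, dif_pos (by omega)]
  exact braidLift_of ..

/-- The value on `A_{r, r+m+1}` of the restriction to the strands in `S`. -/
def restrictedGen (g : ℕ → G) (n M r s : ℕ) (S : ℕ → Bool) : G :=
  if S r = true ∧ S s = true ∧ rankIn S n = M then
    stdPure g (rankIn S r) (rankIn S s - rankIn S r - 1) else 1

theorem restrictionAction_stdPure (hg : IsBraided g (M - 1)) {r m : ℕ} (h : r + m + 1 < n)
    (x : G) (S : ℕ → Bool) : restrictionAction n hg (stdPure (braidSigma n) r m) (x, S) =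
      (restrictedGen g n M r (r + m + 1) S * x, S) := by
  induction m generalizing x S with
  | zero =>
    rw [stdPure, pow_two, map_mul, restrictionAction_sigma hg (by omega)]
    refine Prod.ext ?_ (swapSubset_swapSubset r S)
    simp only [Equiv.Perm.mul_apply, restrictionStep, Equiv.coe_fn_mk, ← mul_assoc]
    congr 1
    simp only [restrictedCrossing, restrictedGen, swapSubset_left, swapSubset_right,
      rankIn_swapSubset S (show n ≠ r + 1 by omega), rankIn_swapSubset S (show r ≠ r + 1 by omega)]
    have c1 : rankIn S (r + 1) = rankIn S r + if S r = true then 1 else 0 := Nat.count_succ ..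
    cases h0 : S r <;> cases h1 : S (r + 1) <;> simp
    split_ifs <;> simp [stdPure, h0, c1, pow_two]
  | succ m ih =>
    set k := r + m + 1 with hk
    rw [stdPure, ← hk, map_mul, map_mul, map_inv, restrictionAction_sigma hg (by omega)]
    have e0 : (restrictionStep g n M k)⁻¹ (x, S) =
        ((restrictedCrossing g n M k (swapSubset k S))⁻¹ * x, swapSubset k S) := rfl
    simp only [Equiv.Perm.mul_apply, e0]
    rw [ih (by omega)]
    refine Prod.ext ?_ (swapSubset_swapSubset k S)
    simp only [restrictionStep, Equiv.coe_fn_mk, ← mul_assoc]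
    congr 1
    have e1 : r + (m + 1) + 1 = k + 1 := by omega
    rw [e1]
    simp only [restrictedCrossing, restrictedGen, swapSubset_left, swapSubset_right,
      rankIn_swapSubset S (show n ≠ k + 1 by omega), rankIn_swapSubset S (show k ≠ k + 1 by omega),
      rankIn_swapSubset S (show r ≠ k + 1 by omega),
      swapSubset_of_ne (t := r) (p := k) S (by omega) (by omega)]
    have c1 : rankIn S (k + 1) = rankIn S k + if S k = true then 1 else 0 := Nat.count_succ ..
    by_cases hr : S r = true ∧ S (k + 1) = true ∧ rankIn S n = M
    swap
    · simp [hr]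
    rw [if_pos hr, if_pos hr, c1]
    -- If the strand in position k survives, the conjugation by crossing k lengthens the restricted
    -- generator by one; if not, that crossing disappears and the ranks do not change.
    by_cases h1 : S k = true
    · have h2 : rankIn S r < rankIn S k := Nat.count_strict_mono hr.1 (by omega)
      obtain ⟨t, ht⟩ : ∃ t, rankIn S k = rankIn S r + t + 1 := ⟨rankIn S k - rankIn S r - 1, by omega⟩
      rw [if_pos ⟨hr.2.1, h1, hr.2.2⟩, if_pos h1, ht]
      have h3 : rankIn S r + t + 1 - rankIn S r - 1 = t := by omega
      have h4 : rankIn S r + t + 1 + 1 - rankIn S r - 1 = t + 1 := by omega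
      rw [h3, h4, stdPure]
    · simp [h1]

/-- It suffices to know this on the generators of `P_n`. Acting by left translations over a fixed S
is what makes restriction multiplicative. -/
theorem exists_restrictionAction_eq (hg : IsBraided g (M - 1)) (S : ℕ → Bool)
    (b : PureBraidGroup n) : ∃ y, ∀ x, restrictionAction n hg b (x, S) = (y * x, S) := by
  have hb : b ∈ Subgroup.closure {y : PureBraidGroup n | ∃ r s : Fin n, r < s ∧ y = pureGen r s} := by
    rw [closure_pureGen]
    trivial
  induction hb using Subgroup.closure_induction with
  | mem b hb =>
    obtain ⟨r, s, hrs, rfl⟩ := hb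
    rw [Fin.lt_def] at hrs
    obtain ⟨m, hm⟩ : ∃ m, (r : ℕ) + m + 1 = s := ⟨s - r - 1, by omega⟩
    rw [coe_pureGen hm]
    exact ⟨_, fun x => restrictionAction_stdPure hg (by omega) x S⟩
  | one => exact ⟨1, fun x => by simp⟩
  | mul a b _ _ ha hb =>
    obtain ⟨y, hy⟩ := ha
    obtain ⟨z, hz⟩ := hb
    exact ⟨y * z, fun x => by simp [hy, hz, mul_assoc]⟩
  | inv a _ ha =>
    obtain ⟨y, hy⟩ := ha
    refine ⟨y⁻¹, fun x => ?_⟩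
    rw [Subgroup.coe_inv, map_inv, Equiv.Perm.inv_eq_iff_eq, hy, mul_inv_cancel_left]

/-- Restriction of pure braids to the strands in `S`, followed by the homomorphism to `G` that is
given by the sequence `g`. -/
def restrictionHom (n : ℕ) (hg : IsBraided g (M - 1)) (S : ℕ → Bool) : PureBraidGroup n →* G where
  toFun b := (restrictionAction n hg b (1, S)).1
  map_one' := by simp
  map_mul' a b := by
    obtain ⟨y, hy⟩ := exists_restrictionAction_eq hg S a
    obtain ⟨z, hz⟩ := exists_restrictionAction_eq hg S b
    simp [hy, hz]

theorem restrictionHom_pureGen (hg : IsBraided g (M - 1)) (S : ℕ → Bool) {r s : Fin n}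
    (h : r < s) : restrictionHom n hg S (pureGen r s) = restrictedGen g n M r s S := by
  rw [Fin.lt_def] at h
  obtain ⟨m, hm⟩ : ∃ m, (r : ℕ) + m + 1 = s := ⟨s - r - 1, by omega⟩
  change (restrictionAction n hg (pureGen r s : BraidGroup n) (1, S)).1 = _
  rw [coe_pureGen hm, restrictionAction_stdPure hg (by omega), mul_one, hm]

end Restriction

/-! ### The action of the braid group on the free group of rank two -/

/-- The action of `σ_1` on `P_3` modulo its centre, which is freely generated by `A_{1,2}` and
`A_{1,3}`. -/
def twistOne : MulAut FreeTwo :=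
  MonoidHom.toMulEquiv (FreeGroup.lift ![freeX, freeY⁻¹ * freeX⁻¹])
    (FreeGroup.lift ![freeX, freeX⁻¹ * freeY⁻¹])
    (FreeGroup.ext_hom _ _ fun a => by fin_cases a <;> simp [freeX, freeY])
    (FreeGroup.ext_hom _ _ fun a => by fin_cases a <;> simp [freeX, freeY])

/-- The action of `σ_2` on `P_3` modulo its centre. -/
def twistTwo : MulAut FreeTwo :=
  MonoidHom.toMulEquiv (FreeGroup.lift ![freeY, freeY⁻¹ * freeX * freeY])
    (FreeGroup.lift ![freeX * freeY * freeX⁻¹, freeX])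
    (FreeGroup.ext_hom _ _ fun a => by fin_cases a <;> simp [freeX, freeY, mul_assoc])
    (FreeGroup.ext_hom _ _ fun a => by fin_cases a <;> simp [freeX, freeY, mul_assoc])

theorem twistOne_X : twistOne freeX = freeX := rfl

theorem twistOne_Y : twistOne freeY = freeY⁻¹ * freeX⁻¹ := rfl

theorem twistTwo_X : twistTwo freeX = freeY := rfl

theorem twistTwo_Y : twistTwo freeY = freeY⁻¹ * freeX * freeY := rfl

theorem mulAut_freeTwo_ext {φ ψ : MulAut FreeTwo} (hX : φ freeX = ψ freeX)
    (hY : φ freeY = ψ freeY) : φ = ψ := by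
  apply MulEquiv.toMonoidHom_injective
  refine FreeGroup.ext_hom _ _ fun a => ?_
  fin_cases a
  · exact hX
  · exact hY

theorem twist_braid : twistOne * twistTwo * twistOne = twistTwo * twistOne * twistTwo :=
  mulAut_freeTwo_ext
    (by simp [twistOne_X, twistOne_Y, twistTwo_X, twistTwo_Y, mul_assoc])
    (by simp [twistOne_X, twistOne_Y, twistTwo_X, twistTwo_Y, mul_assoc])

theorem twistOne_sq : twistOne ^ 2 = MulAut.conj freeX :=
  mulAut_freeTwo_ext
    (by simp [pow_two, twistOne_X])
    (by simp [pow_two, twistOne_X, twistOne_Y])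

/-- A₁₂A₁₃A₂₃ is central in `P_3`, so modulo the centre A₂₃ is the inverse of xy. -/
theorem twistTwo_sq : twistTwo ^ 2 = MulAut.conj (freeY⁻¹ * freeX⁻¹) :=
  mulAut_freeTwo_ext
    (by simp [pow_two, twistTwo_X, twistTwo_Y, mul_assoc])
    (by simp [pow_two, twistTwo_X, twistTwo_Y, mul_assoc])

/-- With the squares inner, this makes every pure generator act by an inner automorphism and
computes the conjugating element one twist at a time. -/
theorem MulAut.mul_conj_mul_inv {G : Type*} [Group G] (φ : MulAut G) (a : G) :
    φ * MulAut.conj a * φ⁻¹ = MulAut.conj (φ a) := by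
  ext b
  simp

/-- The images of the Artin generators of `B_3`, or of those of `B_4` under the homomorphism
`B_4 → B_3` that identifies the first and the third, in the automorphism group of `F_2`. -/
def twistSeq (t : MulAut FreeTwo) (i : ℕ) : MulAut FreeTwo :=
  if i = 0 then twistOne else if i = 1 then twistTwo else if i = 2 then t else 1

theorem isBraided_twistSeq_three : IsBraided (twistSeq 1) (3 - 1) where
  braid i hi := by
    obtain rfl : i = 0 := by omega
    exact twist_braid
  comm i j h := by
    have : twistSeq 1 j = 1 := by
      rw [twistSeq, if_neg (by omega), if_neg (by omega), ite_self]
    rw [this]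
    exact Commute.one_right _

theorem isBraided_twistSeq_four : IsBraided (twistSeq twistOne) (4 - 1) where
  braid i hi := by
    rcases (show i = 0 ∨ i = 1 by omega) with rfl | rfl
    · exact twist_braid
    · exact twist_braid.symm
  comm i j h := by
    by_cases hj : j = 2
    · subst hj
      obtain rfl : i = 0 := by omega
      exact Commute.refl _
    · have : twistSeq twistOne j = 1 := by
        rw [twistSeq, if_neg (by omega), if_neg (by omega), if_neg hj]
      rw [this]
      exact Commute.one_right _

theorem stdPure_twistSeq_zero_zero (t : MulAut FreeTwo) :
    stdPure (twistSeq t) 0 0 = MulAut.conj freeX := twistOne_sq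

theorem stdPure_twistSeq_one_zero (t : MulAut FreeTwo) :
    stdPure (twistSeq t) 1 0 = MulAut.conj (freeY⁻¹ * freeX⁻¹) := twistTwo_sq

theorem stdPure_twistSeq_zero_one (t : MulAut FreeTwo) :
    stdPure (twistSeq t) 0 1 = MulAut.conj freeY := by
  rw [stdPure, stdPure_twistSeq_zero_zero, MulAut.mul_conj_mul_inv]
  exact congrArg _ twistTwo_X

theorem stdPure_twistSeq_two_zero : stdPure (twistSeq twistOne) 2 0 = MulAut.conj freeX :=
  twistOne_sq

theorem stdPure_twistSeq_one_one :
    stdPure (twistSeq twistOne) 1 1 = MulAut.conj (freeX * freeY * freeX⁻¹) := by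
  rw [stdPure, stdPure_twistSeq_one_zero, MulAut.mul_conj_mul_inv]
  change MulAut.conj (twistOne _) = _
  simp [twistOne_X, twistOne_Y]

theorem stdPure_twistSeq_zero_two :
    stdPure (twistSeq twistOne) 0 2 = MulAut.conj (freeY⁻¹ * freeX⁻¹) := by
  rw [stdPure, stdPure_twistSeq_zero_one, MulAut.mul_conj_mul_inv]
  exact congrArg _ twistOne_Y

/-! ### The homomorphisms to the free group of rank two -/

/-- A homomorphism to the automorphism group of `F_2` that takes the generators of `P_n` to inner
automorphisms gives a homomorphism to `F_2`. -/
theorem existsUnique_of_conj {n : ℕ} (v : Fin n → Fin n → FreeTwo)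
    (Φ : PureBraidGroup n →* MulAut FreeTwo)
    (h : ∀ r s, r < s → Φ (pureGen r s) = MulAut.conj (v r s)) :
    ∃! f : PureBraidGroup n →* FreeTwo, ∀ r s, r < s → f (pureGen r s) = v r s := by
  have hΦ : ∀ b, Φ b ∈ (MulAut.conj : FreeTwo →* MulAut FreeTwo).range := by
    have : (⊤ : Subgroup (PureBraidGroup n)) ≤
        (MulAut.conj : FreeTwo →* MulAut FreeTwo).range.comap Φ := by
      rw [← closure_pureGen, Subgroup.closure_le]
      rintro _ ⟨r, s, hrs, rfl⟩
      exact ⟨v r s, (h r s hrs).symm⟩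
    exact fun b => this (Subgroup.mem_top b)
  -- As the centre of `F_2` is trivial, an inner automorphism determines its conjugating element,
  -- multiplicatively.
  let e := MonoidHom.ofInjective conj_injective_freeTwo
  refine ⟨e.symm.toMonoidHom.comp (Φ.codRestrict _ hΦ), fun r s hrs => ?_, fun f hf => ?_⟩
  · refine (MulEquiv.symm_apply_eq e).2 (Subtype.ext ?_)
    exact h r s hrs
  · refine MonoidHom.eq_of_eqOn_dense (closure_pureGen n) ?_
    rintro _ ⟨r, s, hrs, rfl⟩
    rw [hf r s hrs]
    refine ((MulEquiv.symm_apply_eq e).2 (Subtype.ext ?_)).symm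
    exact h r s hrs

theorem rankIn_eq_card {S : ℕ → Bool} {k : ℕ} (T : Finset ℕ) (h : ∀ t, t ∈ T ↔ t < k ∧ S t = true) :
    rankIn S k = T.card := by
  rw [rankIn, Nat.count_eq_card_filter_range]
  congr 1
  ext t
  simp [h]

theorem existsUnique_isThreeStrandMap {n : ℕ} {i j k : Fin n} (hij : i < j) (hjk : j < k) :
    ∃! f : PureBraidGroup n →* FreeTwo, IsThreeStrandMap i j k f := by
  let S : ℕ → Bool := fun t => decide (t = (i : ℕ) ∨ t = (j : ℕ) ∨ t = (k : ℕ))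
  refine existsUnique_of_conj (valueThree i j k)
    (restrictionHom n isBraided_twistSeq_three S) fun r s hrs => ?_
  have hij' := Fin.lt_def.1 hij
  have hjk' := Fin.lt_def.1 hjk
  have ri : rankIn S i = 0 := by
    rw [rankIn_eq_card ∅ fun t => by simp [S]; omega]; rfl
  have rj : rankIn S j = 1 := by
    rw [rankIn_eq_card {(i : ℕ)} fun t => by simp [S]; omega]; rfl
  have rk : rankIn S k = 2 := by
    rw [rankIn_eq_card {(i : ℕ), (j : ℕ)} fun t => by simp [S]; omega]
    exact Finset.card_pair (by omega)
  have rn : rankIn S n = 3 := by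
    rw [rankIn_eq_card {(i : ℕ), (j : ℕ), (k : ℕ)} fun t => by simp [S]; omega]
    exact Finset.card_eq_three.2 ⟨i, j, k, by omega, by omega, by omega, rfl⟩
  have hS : ∀ t : Fin n, S t = true ↔ t = i ∨ t = j ∨ t = k := fun t => by simp [S, Fin.ext_iff]
  rw [restrictionHom_pureGen _ _ hrs, restrictedGen, valueThree]
  simp only [hS, rn, and_true]
  by_cases h : (r = i ∨ r = j ∨ r = k) ∧ (s = i ∨ s = j ∨ s = k)
  · rw [if_pos h]
    rcases h with ⟨rfl | rfl | rfl, rfl | rfl | rfl⟩ <;> first | omega | skip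
    · simp [ri, rj, stdPure_twistSeq_zero_zero]
    · simp [ri, rk, stdPure_twistSeq_zero_one, hjk.ne']
    · simp [rj, rk, stdPure_twistSeq_one_zero, hij.ne']
  · rw [if_neg h, if_neg (by tauto), if_neg (by tauto), if_neg (by tauto), map_one]

theorem existsUnique_isFourStrandMap {n : ℕ} {i j k l : Fin n} (hij : i < j) (hjk : j < k)
    (hkl : k < l) : ∃! f : PureBraidGroup n →* FreeTwo, IsFourStrandMap i j k l f := by
  let S : ℕ → Bool := fun t => decide (t = (i : ℕ) ∨ t = (j : ℕ) ∨ t = (k : ℕ) ∨ t = (l : ℕ))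
  refine existsUnique_of_conj (valueFour i j k l)
    (restrictionHom n isBraided_twistSeq_four S) fun r s hrs => ?_
  have hij' := Fin.lt_def.1 hij
  have hjk' := Fin.lt_def.1 hjk
  have hkl' := Fin.lt_def.1 hkl
  have ri : rankIn S i = 0 := by
    rw [rankIn_eq_card ∅ fun t => by simp [S]; omega]; rfl
  have rj : rankIn S j = 1 := by
    rw [rankIn_eq_card {(i : ℕ)} fun t => by simp [S]; omega]; rfl
  have rk : rankIn S k = 2 := by
    rw [rankIn_eq_card {(i : ℕ), (j : ℕ)} fun t => by simp [S]; omega]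
    exact Finset.card_pair (by omega)
  have rl : rankIn S l = 3 := by
    rw [rankIn_eq_card {(i : ℕ), (j : ℕ), (k : ℕ)} fun t => by simp [S]; omega]
    exact Finset.card_eq_three.2 ⟨i, j, k, by omega, by omega, by omega, rfl⟩
  have rn : rankIn S n = 4 := by
    rw [rankIn_eq_card {(i : ℕ), (j : ℕ), (k : ℕ), (l : ℕ)} fun t => by simp [S]; omega,
      Finset.card_insert_of_notMem (by simp; omega),
      Finset.card_eq_three.2 ⟨(j : ℕ), (k : ℕ), (l : ℕ), by omega, by omega, by omega, rfl⟩]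
  have hS : ∀ t : Fin n, S t = true ↔ t = i ∨ t = j ∨ t = k ∨ t = l := fun t => by
    simp [S, Fin.ext_iff]
  have hik := hij.trans hjk
  have hjl := hjk.trans hkl
  rw [restrictionHom_pureGen _ _ hrs, restrictedGen, valueFour]
  simp only [hS, rn, and_true]
  by_cases h : (r = i ∨ r = j ∨ r = k ∨ r = l) ∧ (s = i ∨ s = j ∨ s = k ∨ s = l)
  · rw [if_pos h]
    rcases h with ⟨rfl | rfl | rfl | rfl, rfl | rfl | rfl | rfl⟩ <;> first | omega | skip
    · simp [ri, rj, stdPure_twistSeq_zero_zero]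
    · simp [ri, rk, stdPure_twistSeq_zero_one, hjk.ne']
    · simp [ri, rl, stdPure_twistSeq_zero_two, hkl.ne', hjl.ne', hij.ne]
    · simp [rj, rk, stdPure_twistSeq_one_zero, hij.ne']
    · simp [rj, rl, stdPure_twistSeq_one_one, hij.ne', hkl.ne']
    · simp [rk, rl, stdPure_twistSeq_two_zero, hik.ne', hjk.ne']
  · rw [if_neg h, if_neg (by tauto), if_neg (by tauto), if_neg (by tauto), if_neg (by tauto),
      if_neg (by tauto), if_neg (by tauto), map_one]

theorem surjective_of_mem_range {G : Type*} [Group G] (f : G →* FreeTwo) (hX : freeX ∈ f.range)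
    (hY : freeY ∈ f.range) : Function.Surjective f := by
  rw [← MonoidHom.range_eq_top, eq_top_iff, ← FreeGroup.closure_range_of, Subgroup.closure_le]
  rintro _ ⟨a, rfl⟩
  fin_cases a
  · exact hX
  · exact hY

theorem IsThreeStrandMap.surjective {n : ℕ} {i j k : Fin n} (hij : i < j) (hjk : j < k)
    {f : PureBraidGroup n →* FreeTwo} (hf : IsThreeStrandMap i j k f) : Function.Surjective f :=
  surjective_of_mem_range f ⟨_, (hf i j hij).trans (by simp [valueThree])⟩
    ⟨_, (hf i k (hij.trans hjk)).trans (by simp [valueThree, hjk.ne'])⟩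

theorem IsFourStrandMap.surjective {n : ℕ} {i j k l : Fin n} (hij : i < j) (hjk : j < k)
    {f : PureBraidGroup n →* FreeTwo} (hf : IsFourStrandMap i j k l f) : Function.Surjective f :=
  surjective_of_mem_range f ⟨_, (hf i j hij).trans (by simp [valueFour])⟩
    ⟨_, (hf i k (hij.trans hjk)).trans (by simp [valueFour, hjk.ne'])⟩

/-! ### Commutation relations on four strands and the images of w -/

section BraidWords

variable {G : Type*} [Group G] {u v w : G}

/-- The full twist on three strands commutes with both generators. -/
theorem commute_fullTwist (h : u * v * u = v * u * v) :
    Commute (u ^ 2 * (v * u ^ 2 * v⁻¹) * v ^ 2) u ∧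
      Commute (u ^ 2 * (v * u ^ 2 * v⁻¹) * v ^ 2) v := by
  -- The full twist is the square of the half twist uvu, and conjugation by the half twist exchanges
  -- u and v.
  have e1 : u ^ 2 * (v * u ^ 2 * v⁻¹) * v ^ 2 = (u * v * u) * (u * v * u) := by
    calc u ^ 2 * (v * u ^ 2 * v⁻¹) * v ^ 2 = u * (u * v * u) * (u * v) := by
          simp only [pow_two]; group
      _ = u * (v * u * v) * (u * v) := by rw [h]
      _ = (u * v * u) * (v * u * v) := by group
      _ = _ := by rw [← h]
  have e2 : SemiconjBy (u * v * u) u v := by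
    calc (u * v * u) * u = v * u * v * u := by rw [h]
      _ = v * (u * v * u) := by group
  have e3 : SemiconjBy (u * v * u) v u := by
    calc (u * v * u) * v = u * (v * u * v) := by group
      _ = u * (u * v * u) := by rw [h]
  rw [e1]
  exact ⟨e3.mul_left e2, e2.mul_left e3⟩

/-- The braid in which the fourth strand encircles the other three commutes with the first two
generators. -/
theorem commute_encircling (h : u * v * u = v * u * v) (h' : v * w * v = w * v * w)
    (huw : Commute u w) : Commute (w * v * u ^ 2 * v * w) u ∧ Commute (w * v * u ^ 2 * v * w) v := by
  rw [pow_two]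
  refine ⟨Eq.symm ?_, Eq.symm ?_⟩
  · calc u * (w * v * (u * u) * v * w) = u * w * v * u * u * v * w := by group
      _ = w * (u * v * u) * u * v * w := by rw [huw.eq]; group
      _ = w * v * u * (v * u * v) * w := by rw [h]; group
      _ = w * v * u * u * v * (u * w) := by rw [← h]; group
      _ = _ := by rw [huw.eq]; group
  · calc v * (w * v * (u * u) * v * w) = v * w * v * u * u * v * w := by group
      _ = w * v * (w * u) * u * v * w := by rw [h']; group
      _ = w * v * (u * w) * u * v * w := by rw [huw.eq]
      _ = w * v * u * (w * u) * v * w := by group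
      _ = w * v * u * (u * w) * v * w := by rw [huw.eq]
      _ = w * v * u * u * (w * v * w) := by group
      _ = _ := by rw [← h']; group

end BraidWords

theorem coe_pureWitness {n : ℕ} (hn : 4 ≤ n) : (pureWitness n hn : BraidGroup n) =
    ⁅⁅braidSigma n 0 ^ 2, braidSigma n 1 ^ 2⁆, ⁅braidSigma n 1 ^ 2, braidSigma n 2 ^ 2⁆⁆ := by
  have h1 := coe_pureGen (i := (⟨0, by omega⟩ : Fin n)) (j := ⟨1, by omega⟩) (m := 0) rfl
  have h2 := coe_pureGen (i := (⟨1, by omega⟩ : Fin n)) (j := ⟨2, by omega⟩) (m := 0) rfl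
  have h3 := coe_pureGen (i := (⟨2, by omega⟩ : Fin n)) (j := ⟨3, by omega⟩) (m := 0) rfl
  simp only [stdPure] at h1 h2 h3
  simp only [pureWitness, commutatorElement_def, Subgroup.coe_mul, Subgroup.coe_inv, h1, h2, h3]

/-- Every homomorphism from `P_n` to a free group kills the witness. -/
theorem map_pureWitness_eq_one {n : ℕ} (hn : 4 ≤ n) {α : Type*}
    (f : PureBraidGroup n →* FreeGroup α) : f (pureWitness n hn) = 1 := by
  have hs := isBraided_braidSigma n
  set u := braidSigma n 0
  set v := braidSigma n 1
  set w := braidSigma n 2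
  have huv : u * v * u = v * u * v := hs.braid 0 (by omega)
  have hvw : v * w * v = w * v * w := hs.braid 1 (by omega)
  have huw : Commute u w := hs.comm 0 2 le_rfl
  let p0 : Fin n := ⟨0, by omega⟩
  let p1 : Fin n := ⟨1, by omega⟩
  let p2 : Fin n := ⟨2, by omega⟩
  let p3 : Fin n := ⟨3, by omega⟩
  have ha : (pureGen p0 p1 : BraidGroup n) = u ^ 2 := coe_pureGen (m := 0) rfl
  have hc : (pureGen p1 p2 : BraidGroup n) = v ^ 2 := coe_pureGen (m := 0) rfl
  have hg : (pureGen p2 p3 : BraidGroup n) = w ^ 2 := coe_pureGen (m := 0) rfl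
  have he : (pureGen p1 p3 : BraidGroup n) = w * v ^ 2 * w⁻¹ := coe_pureGen (m := 1) rfl
  have hd : (pureGen p0 p3 : BraidGroup n) = w * (v * u ^ 2 * v⁻¹) * w⁻¹ :=
    coe_pureGen (m := 2) rfl
  have lift : ∀ {x y : PureBraidGroup n}, Commute (x : BraidGroup n) y → Commute (f x) (f y) :=
    fun h => Commute.map (Subtype.ext h.eq) f
  have key := commutator_commutator_eq_one_of_commute (a := f (pureGen p0 p1))
    (c := f (pureGen p1 p2)) (d := f (pureGen p0 p3)) (e := f (pureGen p1 p3))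
    (g := f (pureGen p2 p3))
  simp only [← map_mul] at key
  -- A₁₄A₂₄A₃₄ is the braid in which the fourth strand encircles the other three.
  have e1 : w * (v * u ^ 2 * v⁻¹) * w⁻¹ * (w * v ^ 2 * w⁻¹) * w ^ 2 = w * v * u ^ 2 * v * w := by
    group
  -- Conjugation by w = σ₃ fixes A₁₂ and takes A₁₃, A₂₃ to A₁₄, A₂₄, so A₁₂A₁₄A₂₄ is a conjugate of
  -- the full twist on the first three strands.
  have e2 : u ^ 2 * (w * (v * u ^ 2 * v⁻¹) * w⁻¹) * (w * v ^ 2 * w⁻¹) =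
      w * (u ^ 2 * (v * u ^ 2 * v⁻¹) * v ^ 2) * w⁻¹ := by
    have : u ^ 2 = w * u ^ 2 * w⁻¹ := by rw [← (huw.pow_left 2).eq, mul_inv_cancel_right]
    nth_rewrite 1 [this]
    group
  have e3 := commute_encircling huv hvw huw
  have e4 : Commute (w * (u ^ 2 * (v * u ^ 2 * v⁻¹) * v ^ 2) * w⁻¹) u := by
    have := (commute_fullTwist huv).1.conj_conj w
    rwa [← huw.eq, mul_inv_cancel_right] at this
  have e5 : Commute (u ^ 2 * (v * u ^ 2 * v⁻¹) * v ^ 2) (v * u ^ 2 * v⁻¹) :=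
    ((commute_fullTwist huv).2.mul_right ((commute_fullTwist huv).1.pow_right 2)).mul_right
      (commute_fullTwist huv).2.inv_right
  have := key (lift ?_) (lift ?_) (lift ?_) (lift ?_) (lift ?_) (lift ?_)
  · rw [← map_commutatorElement, ← map_commutatorElement, ← map_commutatorElement] at this
    exact this
  all_goals simp only [Subgroup.coe_mul, ha, hc, hd, he, hg]
  · rw [e1]
    exact e3.1.pow_right 2
  · rw [e1]
    exact e3.2.pow_right 2
  · exact (commute_fullTwist hvw).1.pow_right 2
  · exact (commute_fullTwist hvw).2.pow_right 2
  · rw [e2]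
    exact e4.pow_right 2
  · rw [e2]
    exact e5.conj_conj w

/-! ### Fox colourings and the nontriviality of w -/

/-- The effect of a crossing on a Fox `3`-colouring of the strands. -/
def colorStep (p : ℕ) : Equiv.Perm (ℕ → ZMod 3) where
  toFun f t := if t = p then 2 * f p - f (p + 1) else if t = p + 1 then f p else f t
  invFun f t := if t = p then f (p + 1) else if t = p + 1 then 2 * f (p + 1) - f p else f t
  left_inv f := by
    funext t
    by_cases h1 : t = p
    · simp [h1]
    · by_cases h2 : t = p + 1 <;> simp [h1, h2]
  right_inv f := by
    funext t
    by_cases h1 : t = p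
    · simp [h1]
    · by_cases h2 : t = p + 1 <;> simp [h1, h2]

theorem colorStep_apply (p : ℕ) (f : ℕ → ZMod 3) (t : ℕ) : colorStep p f t =
    if t = p then 2 * f p - f (p + 1) else if t = p + 1 then f p else f t := rfl

theorem colorStep_braid (p : ℕ) : colorStep p * colorStep (p + 1) * colorStep p =
    colorStep (p + 1) * colorStep p * colorStep (p + 1) := by
  ext1 f
  funext t
  have a1 : p ≠ p + 1 + 1 := by omega
  simp only [Equiv.Perm.mul_apply, colorStep_apply]
  by_cases h0 : t = p
  · simp only [h0, a1, a1.symm, left_eq_add, add_eq_left, one_ne_zero, if_true, if_false]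
    ring
  by_cases h1 : t = p + 1
  · simp [h1, a1, a1.symm]
  by_cases h2 : t = p + 1 + 1 <;> simp [h0, h1, h2, a1, a1.symm]

theorem colorStep_comm {p q : ℕ} (h : p + 2 ≤ q) :
    colorStep p * colorStep q = colorStep q * colorStep p := by
  ext1 f
  funext t
  have a1 : p ≠ q := by omega
  have a2 : p + 1 ≠ q := by omega
  have a3 : p ≠ q + 1 := by omega
  simp only [Equiv.Perm.mul_apply, colorStep_apply]
  by_cases h0 : t = p
  · simp [h0, a1, a2, a3]
  by_cases h1 : t = p + 1
  · simp [h1, a1, a2, a3]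
  by_cases h2 : t = q <;> by_cases h3 : t = q + 1 <;>
    simp [h0, h1, h2, h3, a1.symm, a2.symm, a3.symm]

/-- The action of the braid group on the Fox `3`-colourings of the strands. -/
def colorAction (n : ℕ) : BraidGroup n →* Equiv.Perm (ℕ → ZMod 3) :=
  braidLift (fun i => colorStep i)
    (fun i j h => by rw [← h]; exact colorStep_braid i) (fun i j h => colorStep_comm h)

theorem colorAction_sigma {n p : ℕ} (hp : p < n - 1) :
    colorAction n (braidSigma n p) = colorStep p := by
  rw [braidSigma, dif_pos hp]
  exact braidLift_of ..

/-- The colourings of four strands. -/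
abbrev FourColors : Type := ZMod 3 × ZMod 3 × ZMod 3 × ZMod 3

/-- The extension of a colouring of the first four strands by zero. -/
def extendColors (x : FourColors) : ℕ → ZMod 3
  | 0 => x.1
  | 1 => x.2.1
  | 2 => x.2.2.1
  | 3 => x.2.2.2
  | _ => 0

theorem extendColors_injective : Function.Injective extendColors := fun _ _ h =>
  Prod.ext (congrFun h 0) (Prod.ext (congrFun h 1) (Prod.ext (congrFun h 2) (congrFun h 3)))

/-- The first crossing of four coloured strands. -/
def fourStepZero : Equiv.Perm FourColors where
  toFun x := (2 * x.1 - x.2.1, x.1, x.2.2)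
  invFun x := (x.2.1, 2 * x.2.1 - x.1, x.2.2)
  left_inv x := by simp
  right_inv x := by simp

/-- The second crossing of four coloured strands. -/
def fourStepOne : Equiv.Perm FourColors where
  toFun x := (x.1, 2 * x.2.1 - x.2.2.1, x.2.1, x.2.2.2)
  invFun x := (x.1, x.2.2.1, 2 * x.2.2.1 - x.2.1, x.2.2.2)
  left_inv x := by simp
  right_inv x := by simp

/-- The third crossing of four coloured strands. -/
def fourStepTwo : Equiv.Perm FourColors where
  toFun x := (x.1, x.2.1, 2 * x.2.2.1 - x.2.2.2, x.2.2.1)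
  invFun x := (x.1, x.2.1, x.2.2.2, 2 * x.2.2.2 - x.2.2.1)
  left_inv x := by simp
  right_inv x := by simp

/-- The pairs of permutations that are compatible with a map. -/
def compatiblePairs {X Y : Type*} (T : X → Y) : Subgroup (Equiv.Perm Y × Equiv.Perm X) where
  carrier := {P | ∀ x, P.1 (T x) = T (P.2 x)}
  one_mem' _ := rfl
  mul_mem' {P Q} hP hQ x := by
    change P.1 (Q.1 (T x)) = T (P.2 (Q.2 x))
    rw [hQ, hP]
  inv_mem' {P} hP x := by
    change P.1⁻¹ (T x) = T (P.2⁻¹ x)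
    rw [Equiv.Perm.inv_eq_iff_eq, hP]
    exact congrArg T (P.2.apply_symm_apply x).symm

theorem apply_eq_of_compatible {X Y : Type*} {T : X → Y} {P : Equiv.Perm Y} {p : Equiv.Perm X}
    (h : (P, p) ∈ compatiblePairs T) (hP : P = 1) (x : X) : T (p x) = T x := by
  subst hP
  exact (h x).symm

/-- Transfers the action to the finite set of colourings of four strands, where it can be evaluated.
-/
theorem colorStep_compatible :
    (colorStep 0, fourStepZero) ∈ compatiblePairs extendColors ∧
    (colorStep 1, fourStepOne) ∈ compatiblePairs extendColors ∧
    (colorStep 2, fourStepTwo) ∈ compatiblePairs extendColors := by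
  refine ⟨fun x => ?_, fun x => ?_, fun x => ?_⟩ <;> funext t <;>
    rcases t with _ | _ | _ | _ | t <;> rfl

theorem commutator_fourStep_apply :
    ⁅⁅fourStepZero * fourStepZero, fourStepOne * fourStepOne⁆,
      ⁅fourStepOne * fourStepOne, fourStepTwo * fourStepTwo⁆⁆ (0, 0, 0, 1) ≠ (0, 0, 0, 1) := by
  decide

theorem Subgroup.mk_mul_mem {G H : Type*} [Group G] [Group H] (K : Subgroup (G × H)) {a b : G}
    {x y : H} (h : (a, x) ∈ K) (h' : (b, y) ∈ K) : (a * b, x * y) ∈ K :=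
  K.mul_mem h h'

theorem Subgroup.mk_commutator_mem {G H : Type*} [Group G] [Group H] (K : Subgroup (G × H))
    {a b : G} {x y : H} (h : (a, x) ∈ K) (h' : (b, y) ∈ K) : (⁅a, b⁆, ⁅x, y⁆) ∈ K :=
  K.mul_mem (K.mul_mem (K.mul_mem h h') (K.inv_mem h)) (K.inv_mem h')

/-- Homomorphisms to free groups cannot detect w. Its action on 3-colourings does: it moves the
colouring in which only the fourth strand is nonzero. -/
theorem pureWitness_ne_one {n : ℕ} (hn : 4 ≤ n) : pureWitness n hn ≠ 1 := by
  intro h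
  have h1 : colorAction n (pureWitness n hn) = 1 := by rw [h, Subgroup.coe_one, map_one]
  rw [coe_pureWitness] at h1
  simp only [map_commutatorElement, pow_two, map_mul] at h1
  rw [colorAction_sigma (by omega), colorAction_sigma (by omega), colorAction_sigma (by omega)]
    at h1
  obtain ⟨s0, s1, s2⟩ := colorStep_compatible
  have m0 := Subgroup.mk_mul_mem _ s0 s0
  have m1 := Subgroup.mk_mul_mem _ s1 s1
  have m2 := Subgroup.mk_mul_mem _ s2 s2
  have h2 := Subgroup.mk_commutator_mem _ (Subgroup.mk_commutator_mem _ m0 m1)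
    (Subgroup.mk_commutator_mem _ m1 m2)
  exact commutator_fourStep_apply (extendColors_injective (apply_eq_of_compatible h2 h1 _))

/-! ### Strand deletion and the Brunnian property -/

/-- The pairs of a braid that fixes the position `k` and the braid that is left when the strand in
this position is deleted. -/
def deletionPairs (n : ℕ) (k : Fin n) : Subgroup (BraidGroup n × BraidGroup (n - 1)) where
  carrier := {x | ∀ c, deletionAction n x.1 (c, k) = (x.2 * c, k)}
  one_mem' c := by simp
  mul_mem' {x y} hx hy c := by
    change deletionAction n (x.1 * y.1) (c, k) = (x.2 * y.2 * c, k)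
    rw [map_mul, Equiv.Perm.mul_apply, hy, hx, mul_assoc]
  inv_mem' {x} hx c := by
    change deletionAction n x.1⁻¹ (c, k) = (x.2⁻¹ * c, k)
    rw [map_inv, Equiv.Perm.inv_eq_iff_eq, hx, mul_inv_cancel_left]

/-- The deleted strand enters the first crossing in position k and the second in the swapped
position, and then is back in position k. -/
theorem sigma_sq_mem_deletionPairs {n : ℕ} (k : Fin n) (i : Fin (n - 1)) :
    (braidSigma n i ^ 2, remainingCrossing n i (adjSwap i k) * remainingCrossing n i k) ∈
      deletionPairs n k := by
  intro c
  have h : deletionAction n (braidSigma n i) = deletionStep i := by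
    rw [braidSigma, dif_pos i.2]
    exact braidLift_of ..
  change deletionAction n (braidSigma n i ^ 2) (c, k) = _
  rw [pow_two, map_mul, h]
  simp [deletionStep, adjSwap, mul_assoc]

theorem sigma_sq_mem_deletionPairs_one {n : ℕ} {k : Fin n} {i : ℕ} (hi : i < n - 1)
    (hk : (k : ℕ) = i ∨ (k : ℕ) = i + 1) : (braidSigma n i ^ 2, 1) ∈ deletionPairs n k := by
  have h := sigma_sq_mem_deletionPairs k ⟨i, hi⟩
  have h1 : remainingCrossing n i k = 1 := if_pos hk
  have h2 : remainingCrossing n i (adjSwap ⟨i, hi⟩ k : Fin n) = 1 := by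
    refine if_pos ?_
    rw [adjSwap_val]
    rcases hk with hk | hk <;> simp [hk]
  simp only [h1, h2, mul_one] at h
  exact h

theorem isBrunnian_pureWitness : IsBrunnian (pureWitness 4 le_rfl) := by
  intro k
  suffices h : ((pureWitness 4 le_rfl : BraidGroup 4), (1 : BraidGroup (4 - 1))) ∈
      deletionPairs 4 k from (congrArg Prod.fst (h 1)).trans (mul_one _)
  rw [coe_pureWitness]
  have h0 := sigma_sq_mem_deletionPairs k ⟨0, by omega⟩
  have h1 := sigma_sq_mem_deletionPairs k ⟨1, by omega⟩
  have h2 := sigma_sq_mem_deletionPairs k ⟨2, by omega⟩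
  -- Deleting one of the first two strands trivializes σ₁², deleting one of the last two σ₃²; either
  -- way an inner commutator of w vanishes.
  obtain hk | hk : (k : ℕ) ≤ 1 ∨ 2 ≤ (k : ℕ) := by omega
  · have h0' := sigma_sq_mem_deletionPairs_one (k := k) (i := 0) (by omega) (by omega)
    have := Subgroup.mk_commutator_mem _ (Subgroup.mk_commutator_mem _ h0' h1)
      (Subgroup.mk_commutator_mem _ h1 h2)
    rwa [commutatorElement_one_left, commutatorElement_one_left] at this
  · have h2' := sigma_sq_mem_deletionPairs_one (k := k) (i := 2) (by omega) (by omega)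
    have := Subgroup.mk_commutator_mem _ (Subgroup.mk_commutator_mem _ h0 h1)
      (Subgroup.mk_commutator_mem _ h1 h2')
    rwa [commutatorElement_one_right, commutatorElement_one_right] at this
theorem mainTheorem1 (n : ℕ) (hn : 4 ≤ n) :
    ¬ ResiduallyFree (PureBraidGroup n) ∧
    pureWitness n hn ≠ 1 ∧
    pureWitness n hn ∈ commutator (PureBraidGroup n) ∧
    IsBrunnian (pureWitness 4 le_rfl) ∧
    (∀ i j k : Fin n, i < j → j < k →
      (∃! f : PureBraidGroup n →* FreeTwo, IsThreeStrandMap i j k f) ∧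
      ∀ f : PureBraidGroup n →* FreeTwo, IsThreeStrandMap i j k f →
        Function.Surjective f ∧ f (pureWitness n hn) = 1) ∧
    (∀ i j k l : Fin n, i < j → j < k → k < l →
      (∃! f : PureBraidGroup n →* FreeTwo, IsFourStrandMap i j k l f) ∧
      ∀ f : PureBraidGroup n →* FreeTwo, IsFourStrandMap i j k l f →
        Function.Surjective f ∧ f (pureWitness n hn) = 1) ∧
    (∀ (α : Type*) (f : PureBraidGroup n →* FreeGroup α), f (pureWitness n hn) = 1) := by
  refine ⟨fun h => ?_, pureWitness_ne_one hn,
    Subgroup.commutator_mem_commutator (Subgroup.mem_top _) (Subgroup.mem_top _),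
    isBrunnian_pureWitness, fun i j k hij hjk => ⟨existsUnique_isThreeStrandMap hij hjk,
      fun f hf => ⟨hf.surjective hij hjk, map_pureWitness_eq_one hn f⟩⟩,
    fun i j k l hij hjk hkl => ⟨existsUnique_isFourStrandMap hij hjk hkl,
      fun f hf => ⟨hf.surjective hij hjk, map_pureWitness_eq_one hn f⟩⟩,
    fun α f => map_pureWitness_eq_one hn f⟩
  obtain ⟨α, f, hf⟩ := h _ (pureWitness_ne_one hn)
  exact hf (map_pureWitness_eq_one hn f)
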